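/- Let $d\in\{2,3\}$, $m\in\mathbb N$, and let $\Omega\subset\mathbb R^d$ be a nonempty bounded open set with $\operatorname{int}\overline\Omega=\Omega$ (in particular, any bounded polyhedral Lipschitz domain). Fix $K>0$, $\rho>0$ and $\Lambda$. Consider conforming simplicial triangulations $\mathcal M_h$ of $\overline\Omega$ for which every element has diameter at most $h$ and contains a closed ball of radius $\rho h$ (a shape-regular, quasi-uniform family). Let $V_h=[\mathbb P_1]^m\cap H^1_0(\Omega;\mathbb R^m)$ be the space of continuous piecewise linear vector fields vanishing on $\partial\Omega$. Let $\mathbf n_k\in[\mathbb P_1]^m$, let $\lambda_k\in L^2(\Omega)$ with $\lambda_k\ge 0$ a.e. and $\|\lambda_k\|_{L^2(\Omega)}\le\Lambda$, and let $\gamma\ge 0$. Define $A_{h,\gamma}:V_h\to V_h^*$ by $$\langle A_{h,\gamma}\mathbf u,\mathbf v\rangle = K\langle\nabla\mathbf u,\nabla\mathbf v\rangle_0+2\langle\lambda_k,\mathbf u\cdot\mathbf v\rangle_0+4\gamma\langle\mathbf n_k\cdot\mathbf u,\mathbf n_k\cdot\mathbf v\rangle_0 ,\qquad \|\mathbf u\|_{A_{h,\gamma}}^2=\langle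 A_{h,\gamma}\mathbf u,\mathbf u\rangle .$$ For each vertex $v_i$ of $\mathcal M_h$ let $V_i\subset V_h$ be the star patch space $\{\mathbf u\in V_h:\operatorname{supp}\mathbf u\subset\operatorname{star}(v_i)\}$, where $\operatorname{star}(v_i)$ is the union of the elements containing $v_i$ (or, alternatively for all $i$, the point-block space of those $\mathbf u\in V_h$ that vanish at every vertex other than $v_i$). Let $$N_O=\max_i\#\{j:\ |\operatorname{supp}\mathbf v_i\cap\operatorname{supp}\mathbf v_j|>0\text{ for some }\mathbf v_i\in V_i,\ \mathbf v_j\in V_j\}$$ be the overlap, let $\tilde{\mathcal N}_h=\{\mathbf u\in V_h:\mathbf n_k\cdot\mathbf u=0\text{ at each vertex}\}$ be the approximate kernel, and let $\|\mathrm D\mathbf n_k\|_\infty$ be the $L^\infty(\Omega)$ norm of the Jacobian of $\mathbf n_k$ (with the operator norm on matrices). Then there are a constant $C>0$ and functions $c_1,c_2$ of $h$ with $0<c_1(h),c_2(h)\le C h^{-2}$ for all $h>0$, which depend only on $d,m,\Omega,K,\rho,\Lambda$ (in particular not on $\gamma$, $\mathbf n_k$, $\lambda_k$ or the mesh), such that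 for all such $\mathcal M_h,\gamma,\mathbf n_k,\lambda_k$, with $$c_3(h,\gamma)=C\,\gamma h^2\|\mathrm D\mathbf n_k\|_\infty^2,$$ the following hold: $V_h=\sum_i V_i$; $$\inf_{\mathbf u=\sum_i\mathbf u^i,\ \mathbf u^i\in V_i}\ \sum_i\|\mathbf u^i\|_1^2\le c_1(h)\|\mathbf u\|_0^2\quad\forall\,\mathbf u\in V_h;$$ $$\inf_{\mathbf u_0=\sum_i\mathbf u_0^i,\ \mathbf u_0^i\in V_i}\ \sum_i\|\mathbf u_0^i\|_{A_{h,\gamma}}^2\le\bigl(c_2(h)+c_3(h,\gamma)\bigr)\|\mathbf u_0\|_0^2\quad\forall\,\mathbf u_0\in\tilde{\mathcal N}_h;$$ and the additive Schwarz preconditioner $D_{h,\gamma}:V_h\to V_h^*$ exists, i.e. the map $f\mapsto\sum_i w_i$ on $V_h^*$, where $w_i\in V_i$ solves $\langle A_{h,\gamma}w_i,v\rangle=f(v)$ for all $v\in V_i$, is an isomorphism $V_h^*\to V_h$ with inverse $D_{h,\gamma}$, and it satisfies $$\bigl(c_1(h)+c_2(h)+c_3(h,\gamma)\bigr)^{-1}D_{h,\gamma}\le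 A_{h,\gamma}\le N_O\,D_{h,\gamma}$$ in the sense of the quadratic forms $\mathbf u\mapsto\langle D_{h,\gamma}\mathbf u,\mathbf u\rangle$ and $\mathbf u\mapsto\langle A_{h,\gamma}\mathbf u,\mathbf u\rangle$ on $V_h$. -/

import Mathlib

open MeasureTheory

noncomputable section

namespace LiquidCrystal

/-- Euclidean space of dimension `k`. -/
abbrev E (k : ℕ) : Type := EuclideanSpace ℝ (Fin k)

/-- A (conforming) triangulation of `Ω ⊆ ℝ^d`: a finite geometric simplicial complex whose
`d`-dimensional simplices cover `closure Ω`. Non-overlapping is part of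
`Geometry.SimplicialComplex`: any two simplices meet in a common face or not at all. -/
structure Triangulation (d : ℕ) (Ω : Set (E d)) extends Geometry.SimplicialComplex ℝ (E d) where
  finite_faces : faces.Finite
  cover : (⋃ s ∈ {s ∈ faces | s.card = d + 1}, convexHull ℝ (s : Set (E d))) = closure Ω

namespace Triangulation

variable {d : ℕ} {Ω : Set (E d)}

/-- The vertices of the triangulation, those on the boundary of `Ω` included. -/
abbrev Vertex (T : Triangulation d Ω) : Type := ↥T.toSimplicialComplex.vertices

instance (T : Triangulation d Ω) : Finite T.Vertex :=
  (T.finite_faces.preimage (Finset.singleton_injective.injOn)).to_subtype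

instance (T : Triangulation d Ω) : Fintype T.Vertex := Fintype.ofFinite _

/-- The elements of the mesh: the vertex sets of the `d`-dimensional simplices. -/
def elements (T : Triangulation d Ω) : Set (Finset (E d)) := {s ∈ T.faces | s.card = d + 1}

/-- The mesh is shape regular and quasi-uniform of size `h`, with regularity constant `ρ`: each
element has diameter at most `h` and contains a closed ball of radius `ρ h`. -/
def QuasiUniform (T : Triangulation d Ω) (ρ h : ℝ) : Prop :=
  0 < h ∧ ∀ s ∈ T.elements, Metric.diam (convexHull ℝ (s : Set (E d))) ≤ h ∧
    ∃ x, Metric.closedBall x (ρ * h) ⊆ convexHull ℝ (s : Set (E d))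

/-- `u` agrees with an affine map on every element. Since neighbouring elements are closed and
share their common face, such a `u` is continuous on `closure Ω`, that is `u ∈ [ℙ₁]^m`. -/
def IsP1 (T : Triangulation d Ω) {m : ℕ} (u : E d → E m) : Prop :=
  ∀ s ∈ T.elements, ∃ f : E d →ᵃ[ℝ] E m, Set.EqOn u f (convexHull ℝ (s : Set (E d)))

/-- The finite element space `V_h = [ℙ₁]^m ∩ H¹₀(Ω; ℝ^m)`; its elements are represented by their
extensions by zero to the whole space (so they vanish on the boundary of `Ω`). -/
def Vh (T : Triangulation d Ω) (m : ℕ) : Submodule ℝ (E d → E m) where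
  carrier := {u | T.IsP1 u ∧ ∀ x ∉ Ω, u x = 0}
  zero_mem' := ⟨fun _ _ => ⟨0, fun _ _ => rfl⟩, fun _ _ => rfl⟩
  add_mem' := by
    rintro u v ⟨hu, hu0⟩ ⟨hv, hv0⟩
    refine ⟨fun s hs => ?_, fun x hx => by simp [hu0 x hx, hv0 x hx]⟩
    obtain ⟨f, hf⟩ := hu s hs
    obtain ⟨g, hg⟩ := hv s hs
    exact ⟨f + g, fun x hx => by simp [hf hx, hg hx]⟩
  smul_mem' := by
    rintro c u ⟨hu, hu0⟩
    refine ⟨fun s hs => ?_, fun x hx => by simp [hu0 x hx]⟩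
    obtain ⟨f, hf⟩ := hu s hs
    exact ⟨c • f, fun x hx => by simp [hf hx]⟩

/-- The star of the vertex `p`: the union of the closed elements that contain `p`. -/
def star (T : Triangulation d Ω) (p : E d) : Set (E d) :=
  ⋃ s ∈ {s ∈ T.elements | p ∈ convexHull ℝ (s : Set (E d))}, convexHull ℝ (s : Set (E d))

/-- The star patch space of a vertex: functions in `V_h` supported in the star of the vertex. -/
def starSpace (T : Triangulation d Ω) (m : ℕ) (p : T.Vertex) : Submodule ℝ (T.Vh m) where
  carrier := {u | tsupport (u : E d → E m) ⊆ T.star p}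
  zero_mem' := by
    have h : tsupport (((0 : T.Vh m) : E d → E m)) = ∅ := by
      rw [tsupport_eq_empty_iff]; rfl
    exact h.trans_subset (Set.empty_subset _)
  add_mem' := by
    intro u v hu hv
    exact (tsupport_add (u : E d → E m) (v : E d → E m)).trans (Set.union_subset hu hv)
  smul_mem' := by
    intro c u hu
    exact (tsupport_smul_subset_right (fun _ => c) (u : E d → E m)).trans hu

/-- The point-block patch space of a vertex: the span of the (vector-valued) nodal basis functions
belonging to that vertex, that is the functions in `V_h` vanishing at all other vertices. -/
def pointBlockSpace (T : Triangulation d Ω) (m : ℕ) (p : T.Vertex) : Submodule ℝ (T.Vh m) where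
  carrier := {u | ∀ q : T.Vertex, q ≠ p → (u : E d → E m) q = 0}
  zero_mem' := fun _ _ => rfl
  add_mem' := by
    intro u v hu hv q hq
    simp [hu q hq, hv q hq]
  smul_mem' := by
    intro c u hu q hq
    simp [hu q hq]

/-- The approximate kernel: functions `u ∈ V_h` with `n · u = 0` at each vertex. It contains the
kernel `{u ∈ V_h | n · u = 0 a.e.}`. -/
def approxKernel (T : Triangulation d Ω) {m : ℕ} (n : E d → E m) : Set (T.Vh m) :=
  {u | ∀ p : T.Vertex, inner ℝ (n p) ((u : E d → E m) p) = 0}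

end Triangulation

section Forms

variable {d m : ℕ}

/-- The `L²(Ω)` inner product. -/
def l2 (Ω : Set (E d)) (u v : E d → E m) : ℝ := ∫ x in Ω, inner ℝ (u x) (v x)

/-- The `L²(Ω)` inner product of the gradients (Frobenius product of the Jacobians). Functions
in `V_h` are differentiable off the boundaries of the elements, a null set, and this a.e. derivative
is their weak derivative. -/
def gradL2 (Ω : Set (E d)) (u v : E d → E m) : ℝ :=
  ∫ x in Ω, ∑ j : Fin d, inner ℝ (fderiv ℝ u x (EuclideanSpace.single j 1))
    (fderiv ℝ v x (EuclideanSpace.single j 1))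

/-- The squared `H¹(Ω)` norm. -/
def h1Sq (Ω : Set (E d)) (u : E d → E m) : ℝ := l2 Ω u u + gradL2 Ω u u

/-- The bilinear form of the augmented director block (equal-constant nematic case),
`K⟨∇u, ∇v⟩ + 2⟨lam, u·v⟩ + 4γ⟨n·u, n·v⟩`; it represents the operator `A_{h,γ}`. -/
def aForm (Ω : Set (E d)) (K γ : ℝ) (lam : E d → ℝ) (n : E d → E m) (u v : E d → E m) : ℝ :=
  K * gradL2 Ω u v + 2 * (∫ x in Ω, lam x * inner ℝ (u x) (v x))
    + 4 * γ * ∫ x in Ω, inner ℝ (n x) (u x) * inner ℝ (n x) (v x)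

/-- `‖D n‖_∞`: the essential supremum over `Ω` of the operator norm of the Jacobian of `n`. -/
def jacobianSup (Ω : Set (E d)) (n : E d → E m) : ℝ :=
  (eLpNorm (fun x => fderiv ℝ n x) ⊤ (volume.restrict Ω)).toReal

end Forms

section Schwarz

variable {X ι : Type*} [AddCommGroup X] [Module ℝ X] [Fintype ι]

/-- The infimum of `∑ i, N (w i)` over all splittings `u = ∑ i, w i` with `w i ∈ V i`. -/
def splitInf (V : ι → Submodule ℝ X) (N : X → ℝ) (u : X) : ℝ :=
  sInf {r | ∃ w : ι → X, (∀ i, w i ∈ V i) ∧ ∑ i, w i = u ∧ r = ∑ i, N (w i)}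

/-- `D` is the additive Schwarz preconditioner of the form `a` for the subspaces `V i`:
`D⁻¹ f = ∑ i, w i`, where `w i ∈ V i` solves `a (w i) v = f v` for all `v ∈ V i`. -/
def IsAdditiveSchwarz (V : ι → Submodule ℝ X) (a : X → X → ℝ)
    (D : X ≃ₗ[ℝ] Module.Dual ℝ X) : Prop :=
  ∀ f : Module.Dual ℝ X, ∃ w : ι → X,
    (∀ i, w i ∈ V i ∧ ∀ v ∈ V i, a (w i) v = f v) ∧ D.symm f = ∑ i, w i

end Schwarz

/-- The overlap of the subspaces `V i`: the maximum over `i` of the number of `j` such that some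
`v ∈ V i`, `v' ∈ V j` have supports that intersect in a set of positive measure. -/
def overlap {d m : ℕ} {ι : Type*} {W : Submodule ℝ (E d → E m)} (V : ι → Submodule ℝ W) : ℕ :=
  ⨆ i, {j | ∃ v ∈ V i, ∃ v' ∈ V j,
    0 < volume (tsupport (v : E d → E m) ∩ tsupport (v' : E d → E m))}.ncard

end LiquidCrystal

end

noncomputable section
namespace LiquidCrystal

/-! ### Additive Schwarz theory for positive definite forms on a finite-dimensional space -/

section AbstractSchwarz

variable {X ι : Type*} [AddCommGroup X] [Module ℝ X] [Fintype ι]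

/-! The quadratic form of the additive Schwarz preconditioner is a minimum: `D u u` is the least
value of `∑ i, a (w i) (w i)` over all splittings of `u` (`exists_additiveSchwarz`). Hence an upper
bound for `D` only needs one good splitting. The bound `a ≤ N_O * D` is Cauchy-Schwarz applied to
the optimal splitting, since each patch space has nonzero products with at most `N_O` others
(`energy_sum_le`, `aForm_eq_zero_of_measure_inter`).

The good splitting is the nodal one, `u = ∑ p, φ_p u(p)` with hat functions `φ_p`; its pieces lie in
both kinds of patch space. On each element everything is compared with the discrete norm `vertexSq`,
the sum over the elements of volume times squared vertex values. This norm is bounded by the `L²`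
norm (`mass_bound`, `vertexSq_le`). Gradients of hat functions are at most `1 / (ρ h)`, which gives
the factor `h⁻²` in `sum_gradL2_nodal_le`. The weight enters through its integral over a cell, at
most `|Λ|` times the root of the volume; since `d ≤ 4`, this is at most a multiple of `h⁻²` times
the volume (`QuasiUniform.integral_weight_le`).

For the `γ` term, `n` is frozen at the vertex: `n(x) · u(p) = n(p) · u(p) + (n(x) - n(p)) · u(p)`.
The second summand costs the oscillation of `n` on an element, at most `h ‖Dn‖_∞`, whence `c₃`. On
the approximate kernel the first summand vanishes. For general `u` no splitting into kernel and
complement is needed: the nodal values of `n · u` are bounded by the `L²` norm of `n · u` plus the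
same oscillation term (`vertexSq_director_le`), and `4γ ‖n · u‖²` is part of the energy. The
remaining `L²` norms are absorbed by `poincare`. -/

/-- A positive definite bilinear form solves every variational problem on a subspace, linearly in
the data. -/
theorem exists_localSolver [FiniteDimensional ℝ X] (B : X →ₗ[ℝ] X →ₗ[ℝ] ℝ) (hpos : ∀ u, u ≠ 0 → 0 < B u u)
    (W : Submodule ℝ X) :
    ∃ R : Module.Dual ℝ X →ₗ[ℝ] X, ∀ f, R f ∈ W ∧ ∀ v ∈ W, B (R f) v = f v := by
  let L : W →ₗ[ℝ] Module.Dual ℝ W := (B.compl₁₂ W.subtype W.subtype)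
  have hinj : Function.Injective L := by
    rw [← LinearMap.ker_eq_bot, LinearMap.ker_eq_bot']
    intro w hw
    by_contra hne
    have h := hpos (w : X) (by simpa using hne)
    have h0 : L w w = 0 := by rw [hw]; rfl
    exact h.ne' h0
  let e : W ≃ₗ[ℝ] Module.Dual ℝ W :=
    LinearEquiv.ofInjectiveOfFinrankEq L hinj (Subspace.dual_finrank_eq).symm
  refine ⟨W.subtype ∘ₗ e.symm.toLinearMap ∘ₗ W.dualRestrict, fun f => ⟨?_, fun v hv => ?_⟩⟩
  · exact (e.symm (W.dualRestrict f)).2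
  · have h : L (e.symm (W.dualRestrict f)) = W.dualRestrict f :=
      e.apply_symm_apply (W.dualRestrict f)
    exact congrArg (fun g : Module.Dual ℝ W => g ⟨v, hv⟩) h

/-- The additive Schwarz preconditioner exists, and its quadratic form is the least energy of a
splitting. -/
theorem exists_additiveSchwarz [FiniteDimensional ℝ X] (B : X →ₗ[ℝ] X →ₗ[ℝ] ℝ) (hsymm : ∀ u v, B u v = B v u)
    (hpos : ∀ u, u ≠ 0 → 0 < B u u) (V : ι → Submodule ℝ X) (hV : ⨆ i, V i = ⊤) :
    ∃ D : X ≃ₗ[ℝ] Module.Dual ℝ X, IsAdditiveSchwarz V (fun u v => B u v) D ∧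
      (∀ u, ∃ w : ι → X, (∀ i, w i ∈ V i) ∧ ∑ i, w i = u ∧ D u u = ∑ i, B (w i) (w i)) ∧
      ∀ u, ∀ w : ι → X, (∀ i, w i ∈ V i) → ∑ i, w i = u → D u u ≤ ∑ i, B (w i) (w i) := by
  have hnn : ∀ u, 0 ≤ B u u := fun u => by
    rcases eq_or_ne u 0 with rfl | h
    · simp
    · exact (hpos u h).le
  choose R hR using fun i => exists_localSolver B hpos (V i)
  let S : Module.Dual ℝ X →ₗ[ℝ] X := ∑ i, R i
  have hS : ∀ f, S f = ∑ i, R i f := fun f => by simp [S]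
  have hfS : ∀ f, f (S f) = ∑ i, B (R i f) (R i f) := fun f => by
    rw [hS, map_sum]
    exact Finset.sum_congr rfl fun i _ => ((hR i f).2 _ (hR i f).1).symm
  -- `f (S f)` is the sum of the local energies. If `S f = 0`, all local solutions vanish, so `f`
  -- vanishes on every `V i` and hence on their span.
  have hinj : Function.Injective S := by
    rw [← LinearMap.ker_eq_bot, LinearMap.ker_eq_bot']
    intro f hf
    have h0 : ∑ i, B (R i f) (R i f) = 0 := by rw [← hfS, hf, map_zero]
    rw [Finset.sum_eq_zero_iff_of_nonneg fun i _ => hnn _] at h0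
    have hR0 : ∀ i, R i f = 0 := fun i => by
      by_contra hne
      exact (hpos _ hne).ne' (h0 i (Finset.mem_univ i))
    have hle : ⨆ i, V i ≤ LinearMap.ker f := iSup_le fun i v hv => by
      rw [LinearMap.mem_ker, ← (hR i f).2 v hv, hR0 i]
      simp
    rw [hV, top_le_iff] at hle
    exact LinearMap.ker_eq_top.1 hle
  let e : Module.Dual ℝ X ≃ₗ[ℝ] X :=
    LinearEquiv.ofInjectiveOfFinrankEq S hinj Subspace.dual_finrank_eq
  have he : ∀ u, ∑ i, R i (e.symm u) = u := fun u => by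
    rw [← hS]
    exact e.apply_symm_apply u
  have hD : ∀ u, e.symm u u = ∑ i, B (R i (e.symm u)) (R i (e.symm u)) := fun u => by
    rw [← hfS, hS, he]
  refine ⟨e.symm, fun f => ⟨fun i => R i f, fun i => hR i f, hS f⟩,
    fun u => ⟨fun i => R i (e.symm u), fun i => (hR i _).1, he u, hD u⟩, fun u w hw hu => ?_⟩
  -- For any competing splitting `w`, the local equations tested with `w i` give `D u u` as a mixed
  -- energy; `2ab ≤ a² + b²` then yields `2 D u u ≤ D u u + ∑ i, B (w i) (w i)`.
  have h1 : e.symm u u = ∑ i, B (R i (e.symm u)) (w i) := by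
    conv_lhs => rw [← hu, map_sum]
    rw [hu]
    exact Finset.sum_congr rfl fun i _ => ((hR i _).2 _ (hw i)).symm
  have h2 : ∀ i, 2 * B (R i (e.symm u)) (w i)
      ≤ B (R i (e.symm u)) (R i (e.symm u)) + B (w i) (w i) := fun i => by
    have h := hnn (R i (e.symm u) - w i)
    simp only [map_sub, LinearMap.sub_apply] at h
    rw [hsymm (w i) (R i (e.symm u))] at h
    linarith
  have h3 := Finset.sum_le_sum fun i (_ : i ∈ Finset.univ) => h2 i
  rw [Finset.sum_add_distrib, ← Finset.mul_sum, ← hD, ← h1] at h3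
  linarith

/-- If each subspace interacts with at most `N` of the subspaces, then the energy of a sum is at
most `N` times the sum of the energies. -/
theorem energy_sum_le (B : X →ₗ[ℝ] X →ₗ[ℝ] ℝ) (hsymm : ∀ u v, B u v = B v u)
    (hnn : ∀ u, 0 ≤ B u u) (w : ι → X) (J : ι → Set ι) (hJ : ∀ i j, j ∈ J i ↔ i ∈ J j)
    (h0 : ∀ i j, j ∉ J i → B (w i) (w j) = 0) (N : ℕ) (hN : ∀ i, (J i).ncard ≤ N) :
    B (∑ i, w i) (∑ i, w i) ≤ N * ∑ i, B (w i) (w i) := by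
  classical
  have h2 : ∀ i j, 2 * B (w i) (w j) ≤ B (w i) (w i) + B (w j) (w j) := fun i j => by
    have h := hnn (w i - w j)
    simp only [map_sub, LinearMap.sub_apply] at h
    rw [hsymm (w j) (w i)] at h
    linarith
  have hcard : ∀ i, ∑ j, (if j ∈ J i then B (w i) (w i) else 0) ≤ N * B (w i) (w i) := fun i => by
    rw [← Finset.sum_filter, Finset.sum_const, nsmul_eq_mul]
    refine mul_le_mul_of_nonneg_right ?_ (hnn _)
    have h := hN i
    rw [Set.ncard_eq_toFinset_card'] at h
    have h' : (Finset.univ.filter fun j => j ∈ J i) = (J i).toFinset := by ext; simp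
    rw [h']
    exact_mod_cast h
  -- Only interacting pairs survive in the double sum. Symmetry of `J` lets each of the two squares
  -- be counted along its own index, at most `N` times.
  have h3 : 2 * B (∑ i, w i) (∑ i, w i) ≤
      ∑ i, ∑ j, ((if j ∈ J i then B (w i) (w i) else 0) +
        (if i ∈ J j then B (w j) (w j) else 0)) := by
    simp only [map_sum, LinearMap.sum_apply, Finset.mul_sum]
    rw [Finset.sum_comm]
    refine Finset.sum_le_sum fun i _ => Finset.sum_le_sum fun j _ => ?_
    by_cases h : j ∈ J i
    · rw [if_pos h, if_pos ((hJ i j).1 h)]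
      exact h2 i j
    · rw [if_neg h, if_neg fun h' => h ((hJ i j).2 h'), h0 i j h]
      simp
  simp only [Finset.sum_add_distrib] at h3
  rw [Finset.sum_comm (f := fun i j => if i ∈ J j then B (w j) (w j) else 0)] at h3
  have h4 := Finset.sum_le_sum fun i (_ : i ∈ Finset.univ) => hcard i
  rw [← Finset.mul_sum] at h4
  linarith

end AbstractSchwarz

namespace Triangulation

variable {d : ℕ} {Ω : Set (E d)} (T : Triangulation d Ω)

/-! ### Barycentric coordinates -/

/-- The affine basis formed by the vertices of an element. -/
def elementBasis {s : Finset (E d)} (hs : s ∈ T.elements) : AffineBasis s ℝ (E d) where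
  toFun := (↑)
  ind' := T.indep hs.1
  tot' := by
    rw [(T.indep hs.1).affineSpan_eq_top_iff_card_eq_finrank_add_one]
    simp [hs.2]

open Classical in
/-- The barycentric coordinate of the vertex `p` of the element `s`, as an affine function on the
whole space; zero if `p` is not a vertex of `s`. -/
def bary (s : Finset (E d)) (p : E d) : E d →ᵃ[ℝ] ℝ :=
  if h : s ∈ T.elements ∧ p ∈ s then (T.elementBasis h.1).coord ⟨p, h.2⟩ else 0

variable {T} {s t : Finset (E d)}

theorem bary_of_mem (hs : s ∈ T.elements) {p : E d} (hp : p ∈ s) :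
    T.bary s p = (T.elementBasis hs).coord ⟨p, hp⟩ := dif_pos ⟨hs, hp⟩

theorem bary_of_notMem {p : E d} (hp : p ∉ s) : T.bary s p = 0 := dif_neg fun h => hp h.2

theorem range_elementBasis (hs : s ∈ T.elements) :
    Set.range (T.elementBasis hs) = (s : Set (E d)) :=
  Subtype.range_coe

open Classical in
theorem bary_vertex (hs : s ∈ T.elements) (p : E d) {q : E d} (hq : q ∈ s) :
    T.bary s p q = if p = q then 1 else 0 := by
  by_cases hp : p ∈ s
  · rw [bary_of_mem hs hp]
    have h := (T.elementBasis hs).coord_apply ⟨p, hp⟩ ⟨q, hq⟩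
    simp only [Subtype.mk.injEq] at h
    exact h
  · rw [bary_of_notMem hp, if_neg]
    · rfl
    · rintro rfl
      exact hp hq

theorem sum_bary (hs : s ∈ T.elements) (x : E d) : ∑ p ∈ s, T.bary s p x = 1 := by
  rw [← Finset.sum_coe_sort, ← (T.elementBasis hs).sum_coord_apply_eq_one x]
  exact Finset.sum_congr rfl fun p _ => by rw [bary_of_mem hs p.2]

theorem sum_bary_smul (hs : s ∈ T.elements) {F : Type*} [AddCommGroup F] [Module ℝ F]
    (f : E d →ᵃ[ℝ] F) (x : E d) : ∑ p ∈ s, T.bary s p x • f p = f x := by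
  have h := (T.elementBasis hs).affineCombination_coord_eq_self x
  have h1 := (T.elementBasis hs).sum_coord_apply_eq_one x
  conv_rhs => rw [← h]
  rw [Finset.univ.map_affineCombination _ _ h1,
    Finset.univ.affineCombination_eq_linear_combination _ _ h1, ← Finset.sum_coe_sort]
  refine Finset.sum_congr rfl fun p _ => ?_
  rw [bary_of_mem hs p.2]
  rfl

theorem mem_convexHull_iff_bary (hs : s ∈ T.elements) {x : E d} :
    x ∈ convexHull ℝ (s : Set (E d)) ↔ ∀ p ∈ s, 0 ≤ T.bary s p x := by
  rw [← range_elementBasis hs, AffineBasis.convexHull_eq_nonneg_coord]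
  constructor
  · intro h p hp
    rw [bary_of_mem hs hp]
    exact h ⟨p, hp⟩
  · rintro h ⟨p, hp⟩
    rw [← bary_of_mem hs hp]
    exact h p hp

theorem bary_nonneg (hs : s ∈ T.elements) {x : E d} (hx : x ∈ convexHull ℝ (s : Set (E d)))
    (p : E d) : 0 ≤ T.bary s p x := by
  by_cases hp : p ∈ s
  · exact (mem_convexHull_iff_bary hs).1 hx p hp
  · rw [bary_of_notMem hp]
    exact le_rfl

theorem bary_le_one (hs : s ∈ T.elements) {x : E d} (hx : x ∈ convexHull ℝ (s : Set (E d)))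
    (p : E d) : T.bary s p x ≤ 1 := by
  by_cases hp : p ∈ s
  · rw [← sum_bary hs x]
    exact Finset.single_le_sum (f := fun q => T.bary s q x) (fun q _ => bary_nonneg hs hx q) hp
  · rw [bary_of_notMem hp]
    exact zero_le_one

/-- Barycentric coordinates of a common point of two elements agree. -/
theorem bary_congr (hs : s ∈ T.elements) (ht : t ∈ T.elements) {x : E d}
    (hxs : x ∈ convexHull ℝ (s : Set (E d))) (hxt : x ∈ convexHull ℝ (t : Set (E d))) (p : E d) :
    T.bary s p x = T.bary t p x := by
  -- The common point lies in the hull of the shared vertices, where the affine difference of the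
  -- two coordinates vanishes.
  have hx := T.inter_subset_convexHull hs.1 ht.1 ⟨hxs, hxt⟩
  let g : E d →ᵃ[ℝ] ℝ := T.bary s p - T.bary t p
  have hsub : ((s : Set (E d)) ∩ t) ⊆ g ⁻¹' {0} := by
    rintro q ⟨hqs, hqt⟩
    simp only [g, Set.mem_preimage, Set.mem_singleton_iff, AffineMap.coe_sub, Pi.sub_apply]
    rw [bary_vertex hs p hqs, bary_vertex ht p hqt, sub_self]
  have h := convexHull_min hsub ((convex_singleton (0 : ℝ)).affine_preimage g) hx
  simp only [g, Set.mem_preimage, Set.mem_singleton_iff, AffineMap.coe_sub, Pi.sub_apply] at h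
  linarith

/-! ### Elements and cells -/

theorem finite_elements (T : Triangulation d Ω) : T.elements.Finite :=
  T.finite_faces.subset fun _ h => h.1

/-- The elements of the mesh as a finite set. -/
def elems (T : Triangulation d Ω) : Finset (Finset (E d)) := T.finite_elements.toFinset

theorem mem_elems : s ∈ T.elems ↔ s ∈ T.elements := T.finite_elements.mem_toFinset

theorem exists_mem_element {x : E d} (hx : x ∈ closure Ω) :
    ∃ s ∈ T.elements, x ∈ convexHull ℝ (s : Set (E d)) := by
  rw [← T.cover] at hx
  simpa [elements] using hx

theorem convexHull_subset_closure (hs : s ∈ T.elements) :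
    convexHull ℝ (s : Set (E d)) ⊆ closure Ω := by
  rw [← T.cover]
  exact Set.subset_biUnion_of_mem (u := fun s : Finset (E d) => convexHull ℝ (s : Set (E d))) hs

theorem isCompact_element (s : Finset (E d)) : IsCompact (convexHull ℝ (s : Set (E d))) :=
  s.finite_toSet.isCompact_convexHull ℝ

theorem mem_vertices_of_mem_element (hs : s ∈ T.elements) {p : E d} (hp : p ∈ s) :
    p ∈ T.toSimplicialComplex.vertices :=
  T.down_closed hs.1 (Finset.singleton_subset_iff.2 hp) (Finset.singleton_nonempty p)

/-- The faces `{p}` and `s` meet in the hull of their shared vertices; as this hull is nonempty, `p`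
must be shared. -/
theorem vertex_mem_of_mem_convexHull (hs : s ∈ T.elements) {p : E d}
    (hp : p ∈ T.toSimplicialComplex.vertices) (hps : p ∈ convexHull ℝ (s : Set (E d))) :
    p ∈ s := by
  have h := T.inter_subset_convexHull hp hs.1
    ⟨subset_convexHull ℝ _ (by simp : p ∈ (({p} : Finset (E d)) : Set (E d))), hps⟩
  obtain ⟨q, hq⟩ := convexHull_nonempty_iff.1 ⟨p, h⟩
  have hqp : q = p := by simpa using hq.1
  exact hqp ▸ hq.2

/-- The interior of an element. -/
def cell (s : Finset (E d)) : Set (E d) := interior (convexHull ℝ (s : Set (E d)))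

theorem isOpen_cell (s : Finset (E d)) : IsOpen (cell s) := isOpen_interior

theorem cell_subset (s : Finset (E d)) : cell s ⊆ convexHull ℝ (s : Set (E d)) := interior_subset

theorem bary_pos (hs : s ∈ T.elements) {x : E d} (hx : x ∈ cell s) {p : E d} (hp : p ∈ s) :
    0 < T.bary s p x := by
  rw [cell, ← range_elementBasis hs, AffineBasis.interior_convexHull] at hx
  rw [bary_of_mem hs hp]
  exact hx ⟨p, hp⟩

/-- In a common interior point every vertex of `s` has positive coordinate. By agreement of the
coordinates it is positive for `t` too, so `s ⊆ t`, and conversely. -/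
theorem pairwise_disjoint_cell : Set.Pairwise (T.elems : Set (Finset (E d)))
    (Function.onFun Disjoint cell) := by
  intro s hs t ht hst
  rw [Finset.mem_coe, mem_elems] at hs ht
  rw [Function.onFun, Set.disjoint_left]
  intro x hxs hxt
  have key : ∀ {s t : Finset (E d)}, s ∈ T.elements → t ∈ T.elements → x ∈ cell s → x ∈ cell t →
      s ⊆ t := by
    intro s t hs ht hxs hxt p hp
    by_contra hpt
    have h := bary_pos hs hxs hp
    rw [bary_congr hs ht (cell_subset s hxs) (cell_subset t hxt), bary_of_notMem hpt] at h
    exact lt_irrefl _ h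
  exact hst ((key hs ht hxs hxt).antisymm (key ht hs hxt hxs))

theorem cell_subset_domain (hΩ : interior (closure Ω) = Ω) (hs : s ∈ T.elements) :
    cell s ⊆ Ω := by
  rw [← hΩ]
  exact interior_mono (convexHull_subset_closure hs)

theorem measure_element_sdiff_cell (s : Finset (E d)) :
    volume (convexHull ℝ (s : Set (E d)) \ cell s) = 0 := by
  refine measure_mono_null ?_ ((convex_convexHull ℝ (s : Set (E d))).addHaar_frontier volume)
  rintro x ⟨hx, hx'⟩
  exact ⟨subset_closure hx, hx'⟩

/-- Only boundaries of elements are missed, and the frontier of a convex set is null. Together with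
the disjointness of the cells this reduces every integral to single elements. -/
theorem iUnion_cell_ae_eq (T : Triangulation d Ω) (hΩ : interior (closure Ω) = Ω) :
    (⋃ s ∈ T.elems, cell s) =ᵐ[volume] Ω := by
  have h1 : (⋃ s ∈ T.elems, cell s) ⊆ Ω :=
    Set.iUnion₂_subset fun s hs => cell_subset_domain hΩ (mem_elems.1 hs)
  refine h1.eventuallyLE.antisymm ?_
  rw [ae_le_set]
  refine measure_mono_null (t := ⋃ s ∈ T.elems, (convexHull ℝ (s : Set (E d)) \ cell s)) ?_ ?_
  · rintro x ⟨hx, hx'⟩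
    obtain ⟨s, hs, hxs⟩ := exists_mem_element (T := T) (subset_closure hx)
    simp only [Set.mem_iUnion] at hx' ⊢
    exact ⟨s, mem_elems.2 hs, hxs, fun h => hx' ⟨s, mem_elems.2 hs, h⟩⟩
  · exact (measure_biUnion_null_iff T.elems.countable_toSet).2
      fun s _ => measure_element_sdiff_cell s

/-- Integrals over the domain are sums of integrals over the cells. -/
theorem integral_eq_sum_cell (T : Triangulation d Ω) (hΩ : interior (closure Ω) = Ω)
    {f : E d → ℝ} (hf : IntegrableOn f Ω) :
    ∫ x in Ω, f x = ∑ s ∈ T.elems, ∫ x in cell s, f x := by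
  rw [← integral_biUnion_finset T.elems (fun s _ => (isOpen_cell s).measurableSet)
    pairwise_disjoint_cell fun s hs =>
      hf.mono_set (cell_subset_domain hΩ (mem_elems.1 hs))]
  exact (setIntegral_congr_set (T.iUnion_cell_ae_eq hΩ)).symm

theorem ae_mem_cell (T : Triangulation d Ω) (hΩ : interior (closure Ω) = Ω) :
    ∀ᵐ x ∂(volume.restrict Ω), ∃ s ∈ T.elements, x ∈ cell s := by
  have h : ∀ᵐ x ∂(volume.restrict (⋃ s ∈ T.elems, cell s)), ∃ s ∈ T.elements, x ∈ cell s := by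
    refine ae_restrict_of_forall_mem
      (Finset.measurableSet_biUnion _ fun s _ => (isOpen_cell s).measurableSet) fun x hx => ?_
    simpa [mem_elems] using hx
  rwa [Measure.restrict_congr_set (T.iUnion_cell_ae_eq hΩ)] at h

/-! ### Hat functions and the nodal splitting -/

variable (T) in
open Classical in
/-- The nodal basis function of the vertex `p`, extended by zero. -/
def hat (p x : E d) : ℝ :=
  if h : ∃ s ∈ T.elements, x ∈ convexHull ℝ (s : Set (E d)) then T.bary h.choose p x else 0

theorem hat_eq_bary (hs : s ∈ T.elements) {x : E d} (hx : x ∈ convexHull ℝ (s : Set (E d)))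
    (p : E d) : T.hat p x = T.bary s p x := by
  have h : ∃ s ∈ T.elements, x ∈ convexHull ℝ (s : Set (E d)) := ⟨s, hs, hx⟩
  rw [hat, dif_pos h]
  exact bary_congr h.choose_spec.1 hs h.choose_spec.2 hx p

theorem hat_of_notMem_closure {x : E d} (hx : x ∉ closure Ω) (p : E d) : T.hat p x = 0 :=
  dif_neg fun ⟨_, hs, hxs⟩ => hx (convexHull_subset_closure hs hxs)

/-- The nodal basis function of an interior vertex vanishes outside of the domain. -/
theorem hat_of_notMem (hΩo : IsOpen Ω) (hΩ : interior (closure Ω) = Ω) {p : E d} (hp : p ∈ Ω)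
    {x : E d} (hx : x ∉ Ω) : T.hat p x = 0 := by
  classical
  by_contra hne
  apply hx
  have hxc : x ∈ closure Ω := by
    by_contra h
    exact hne (hat_of_notMem_closure h p)
  obtain ⟨s, hs, hxs⟩ := exists_mem_element (T := T) hxc
  rw [hat_eq_bary hs hxs] at hne
  have hpos : 0 < T.bary s p x := lt_of_le_of_ne (bary_nonneg hs hxs p) (Ne.symm hne)
  have hps : p ∈ s := by
    by_contra h
    rw [bary_of_notMem h] at hpos
    exact lt_irrefl _ hpos
  -- The aim is that a neighbourhood of `x` lies in `closure Ω`, contradicting `x ∉ Ω`. Points `z`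
  -- near `x` are contracted towards `p` by the factor `r`, which moves them into `Ω`, where some
  -- element contains them; that element then turns out to contain `z` itself.
  obtain ⟨r, hr0, hr1, hrΩ⟩ : ∃ r : ℝ, 0 < r ∧ r < 1 ∧ AffineMap.lineMap p x r ∈ Ω := by
    have hc : Filter.Tendsto (fun r : ℝ => AffineMap.lineMap p x r) (nhds 0) (nhds p) := by
      have h := (AffineMap.lineMap_continuous (R := ℝ) (p := p) (q := x)).tendsto 0
      rwa [AffineMap.lineMap_apply_zero] at h
    have h1 := (hc.mono_left (nhdsWithin_le_nhds (s := Set.Ioi 0))).eventually (hΩo.mem_nhds hp)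
    have h2 : ∀ᶠ r in nhdsWithin (0 : ℝ) (Set.Ioi 0), r ∈ Set.Ioo (0 : ℝ) 1 :=
      Ioo_mem_nhdsGT one_pos
    obtain ⟨r, hr, hr'⟩ := (h1.and h2).exists
    exact ⟨r, hr'.1, hr'.2, hr⟩
  have hcont : Continuous fun z : E d => AffineMap.lineMap p z r := by
    simp only [AffineMap.lineMap_apply]
    fun_prop
  have hline : ∀ (t : Finset (E d)) (q z : E d),
      T.bary t q (AffineMap.lineMap p z r) = (1 - r) * T.bary t q p + r * T.bary t q z := by
    intro t q z
    rw [AffineMap.apply_lineMap, AffineMap.lineMap_apply_module]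
    simp
  have hys : AffineMap.lineMap p x r ∈ convexHull ℝ (s : Set (E d)) :=
    (convex_convexHull ℝ _).lineMap_mem (subset_convexHull ℝ _ hps) hxs ⟨hr0.le, hr1.le⟩
  have key : ∀ t ∈ T.elems, ∀ᶠ z in nhds x,
      AffineMap.lineMap p z r ∈ convexHull ℝ (t : Set (E d)) →
        z ∈ convexHull ℝ (t : Set (E d)) := by
    intro t ht
    rw [mem_elems] at ht
    by_cases hyt : AffineMap.lineMap p x r ∈ convexHull ℝ (t : Set (E d))
    -- If `t` contains the contracted `x`, then `p` is a vertex of `t`. Contraction towards `p`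
    -- multiplies all other coordinates by `r > 0`, so their signs are preserved; the coordinate at
    -- `p` is positive near `x` by continuity.
    · have hpos' : 0 < T.bary t p (AffineMap.lineMap p x r) := by
        rw [← bary_congr hs ht hys hyt, hline, bary_vertex hs p hps, if_pos rfl]
        nlinarith
      have hpt : p ∈ t := by
        by_contra h
        rw [bary_of_notMem h] at hpos'
        exact lt_irrefl _ hpos'
      have hxt : 0 < T.bary t p x := by
        have h := bary_congr hs ht hys hyt p
        rw [hline, hline, bary_vertex hs p hps, bary_vertex ht p hpt] at h
        have h' : T.bary s p x = T.bary t p x := by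
          have h3 : r * T.bary s p x = r * T.bary t p x := by linarith
          exact mul_left_cancel₀ hr0.ne' h3
        rwa [← h']
      have hct : Continuous (T.bary t p) := (T.bary t p).continuous_of_finiteDimensional
      filter_upwards [hct.continuousAt.eventually (lt_mem_nhds hxt)] with z hz hyz
      rw [mem_convexHull_iff_bary ht]
      intro q hq
      by_cases hqp : q = p
      · rw [hqp]
        exact hz.le
      · have h := bary_nonneg ht hyz q
        rw [hline, bary_vertex ht q hpt, if_neg hqp, mul_zero, zero_add] at h
        exact nonneg_of_mul_nonneg_right h hr0
    -- Elements missing the contracted `x` are closed, so they also miss the contractions of nearby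
    -- points.
    · have hopen : IsOpen (convexHull ℝ (t : Set (E d)))ᶜ :=
        (isCompact_element t).isClosed.isOpen_compl
      filter_upwards [hcont.continuousAt.eventually (hopen.mem_nhds hyt)] with z hz hyz
      exact absurd hyz hz
  have hall : ∀ᶠ z in nhds x, ∀ t ∈ T.elems,
      AffineMap.lineMap p z r ∈ convexHull ℝ (t : Set (E d)) →
        z ∈ convexHull ℝ (t : Set (E d)) :=
    (Filter.eventually_all_finset T.elems).2 key
  rw [← hΩ, mem_interior_iff_mem_nhds]
  filter_upwards [hall, hcont.continuousAt.eventually (hΩo.mem_nhds hrΩ)] with z hz hyz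
  obtain ⟨t, ht, hyt⟩ := exists_mem_element (T := T) (subset_closure hyz)
  exact convexHull_subset_closure ht (hz t (mem_elems.2 ht) hyt)

variable {m : ℕ}

theorem isP1_hat_smul (p : E d) (v : E m) : T.IsP1 fun x => T.hat p x • v := fun s hs =>
  ⟨(LinearMap.toSpanSingleton ℝ (E m) v).toAffineMap.comp (T.bary s p), fun x hx => by
    simp [hat_eq_bary hs hx]⟩

/-- The component of `u` at the vertex `p` in the nodal basis. -/
def nodal (hΩo : IsOpen Ω) (hΩ : interior (closure Ω) = Ω) (u : T.Vh m) (p : E d) : T.Vh m :=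
  ⟨fun x => T.hat p x • (u : E d → E m) p, isP1_hat_smul p _, fun x hx => by
    beta_reduce
    -- For an interior vertex the hat function vanishes off `Ω`; for any other vertex the
    -- coefficient `u p` is already zero.
    by_cases hp : p ∈ Ω
    · rw [hat_of_notMem hΩo hΩ hp hx, zero_smul]
    · rw [u.2.2 p hp, smul_zero]⟩

theorem nodal_apply (hΩo : IsOpen Ω) (hΩ : interior (closure Ω) = Ω) (u : T.Vh m) (p x : E d) :
    (nodal hΩo hΩ u p : E d → E m) x = T.hat p x • (u : E d → E m) p := rfl

theorem isP1_apply {u : E d → E m} (hu : T.IsP1 u) (hs : s ∈ T.elements) {x : E d}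
    (hx : x ∈ convexHull ℝ (s : Set (E d))) : u x = ∑ p ∈ s, T.bary s p x • u p := by
  obtain ⟨f, hf⟩ := hu s hs
  rw [hf hx, ← sum_bary_smul hs]
  exact Finset.sum_congr rfl fun p hp => by rw [hf (subset_convexHull ℝ _ hp)]

theorem sum_vertex_eq {F : Type*} [AddCommMonoid F] (hs : s ∈ T.elements) (g : E d → F)
    (hg : ∀ p ∉ s, g p = 0) : ∑ p : T.Vertex, g p = ∑ p ∈ s, g p := by
  classical
  rw [← Finset.sum_subtype_of_mem (p := fun p => p ∈ T.toSimplicialComplex.vertices) g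
    fun p hp => mem_vertices_of_mem_element hs hp]
  symm
  refine Finset.sum_subset (fun _ _ => Finset.mem_univ _) fun p _ hp => hg p fun h => hp ?_
  simpa using h

theorem sum_nodal (hΩo : IsOpen Ω) (hΩ : interior (closure Ω) = Ω) (u : T.Vh m) :
    ∑ p : T.Vertex, nodal hΩo hΩ u p = u := by
  apply Subtype.ext
  funext x
  rw [AddSubmonoidClass.coe_finsetSum, Finset.sum_apply]
  simp only [nodal_apply]
  by_cases hx : x ∈ closure Ω
  · obtain ⟨s, hs, hxs⟩ := exists_mem_element (T := T) hx
    rw [isP1_apply u.2.1 hs hxs]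
    simp only [hat_eq_bary hs hxs]
    exact sum_vertex_eq hs (fun p => T.bary s p x • (u : E d → E m) p) fun p hp => by
      simp [bary_of_notMem hp]
  · rw [u.2.2 x fun h => hx (subset_closure h)]
    exact Finset.sum_eq_zero fun p _ => by rw [hat_of_notMem_closure hx, zero_smul]

theorem isClosed_star (p : E d) : IsClosed (T.star p) :=
  (T.finite_elements.subset fun _ h => h.1).isClosed_biUnion fun s _ =>
    (isCompact_element s).isClosed

theorem nodal_mem_starSpace (hΩo : IsOpen Ω) (hΩ : interior (closure Ω) = Ω) (u : T.Vh m)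
    (p : T.Vertex) : nodal hΩo hΩ u p ∈ T.starSpace m p := by
  refine closure_minimal (fun x hx => ?_) (isClosed_star _)
  have hne : T.hat p x ≠ 0 := fun h => hx (by simp only [nodal_apply, h, zero_smul])
  have hxc : x ∈ closure Ω := by
    by_contra h
    exact hne (hat_of_notMem_closure h p)
  obtain ⟨s, hs, hxs⟩ := exists_mem_element (T := T) hxc
  rw [hat_eq_bary hs hxs] at hne
  have hps : (p : E d) ∈ s := by
    by_contra h
    exact hne (by rw [bary_of_notMem h]; rfl)
  exact Set.mem_biUnion (show s ∈ {s ∈ T.elements | (p : E d) ∈ convexHull ℝ (s : Set (E d))} from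
    ⟨hs, subset_convexHull ℝ _ hps⟩) hxs

theorem nodal_mem_pointBlockSpace (hΩo : IsOpen Ω) (hΩ : interior (closure Ω) = Ω) (u : T.Vh m)
    (p : T.Vertex) : nodal hΩo hΩ u p ∈ T.pointBlockSpace m p := by
  intro q hq
  rw [nodal_apply]
  by_cases hqc : (q : E d) ∈ closure Ω
  · obtain ⟨s, hs, hqs⟩ := exists_mem_element (T := T) hqc
    rw [hat_eq_bary hs hqs, bary_vertex hs _ (vertex_mem_of_mem_convexHull hs q.2 hqs), if_neg,
      zero_smul]
    exact fun h => hq (Subtype.ext h.symm)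
  · rw [hat_of_notMem_closure hqc, zero_smul]

instance finiteDimensional_Vh (T : Triangulation d Ω) : FiniteDimensional ℝ (T.Vh m) := by
  let L : T.Vh m →ₗ[ℝ] (T.Vertex → E m) :=
    { toFun := fun u p => (u : E d → E m) p
      map_add' := fun _ _ => rfl
      map_smul' := fun _ _ => rfl }
  refine FiniteDimensional.of_injective L ?_
  rw [← LinearMap.ker_eq_bot, LinearMap.ker_eq_bot']
  intro u hu
  apply Subtype.ext
  funext x
  by_cases hx : x ∈ closure Ω
  · obtain ⟨s, hs, hxs⟩ := exists_mem_element (T := T) hx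
    rw [isP1_apply u.2.1 hs hxs]
    refine Finset.sum_eq_zero fun p hp => ?_
    have h : (u : E d → E m) p = 0 := congrFun hu ⟨p, mem_vertices_of_mem_element hs hp⟩
    rw [h, smul_zero]
  · exact u.2.2 x fun h => hx (subset_closure h)

end Triangulation

/-- A continuous function that is Lipschitz on each set of a finite closed cover of a normed space
is Lipschitz. -/
theorem lipschitzWith_of_finite_closed_cover {X F ι : Type*} [NormedAddCommGroup X]
    [NormedSpace ℝ X] [NormedAddCommGroup F] [Finite ι] (A : ι → Set X)
    (hA : ∀ i, IsClosed (A i)) (hcov : ∀ x, ∃ i, x ∈ A i) {u : X → F} (hu : Continuous u)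
    {L : NNReal} (hL : ∀ i, LipschitzOnWith L u (A i)) : LipschitzWith L u := by
  refine LipschitzWith.of_dist_le_mul fun y x => ?_
  let γ : ℝ → X := fun t => AffineMap.lineMap x y t
  have hγ : Continuous γ := AffineMap.lineMap_continuous
  have hγd : ∀ a b, dist (γ a) (γ b) = |a - b| * dist x y := fun a b => by
    rw [dist_lineMap_lineMap, Real.dist_eq]
  let S : Set ℝ := {t | dist (u (γ t)) (u x) ≤ L * (t * dist x y)}
  have hS : IsClosed S := isClosed_le (by fun_prop) (by fun_prop)
  have h0 : (0 : ℝ) ∈ S := by simp [S, γ]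
  have hsub : Set.Icc (0 : ℝ) 1 ⊆ S := by
    -- Continuous induction along the segment: `S` is closed and contains `0`, so it suffices to
    -- advance a little to the right of each of its points.
    refine (hS.inter isClosed_Icc).Icc_subset_of_forall_exists_gt h0 ?_
    rintro t ⟨htS, ht0, -⟩ b hb
    -- Finitely many sets cover the segment, so one is met arbitrarily close to the right of `t`.
    -- Being closed, it also contains `γ t`, and its Lipschitz bound applies between the two points.
    obtain ⟨i, hi⟩ : ∃ i, ∃ᶠ r in nhdsWithin t (Set.Ioi t), γ r ∈ A i := by
      by_contra hcon
      simp only [not_exists, Filter.not_frequently] at hcon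
      have hall := Filter.eventually_all.2 hcon
      obtain ⟨r, hr⟩ := hall.exists
      obtain ⟨i, hi⟩ := hcov (γ r)
      exact hr i hi
    have hti : γ t ∈ A i :=
      (hA i).mem_of_frequently_of_tendsto hi (hγ.continuousAt.mono_left nhdsWithin_le_nhds)
    have hnear : ∀ᶠ r in nhdsWithin t (Set.Ioi t), r ∈ Set.Ioc t b := Ioc_mem_nhdsGT hb
    obtain ⟨r, hri, hr⟩ := (hi.and_eventually hnear).exists
    refine ⟨r, ?_, hr⟩
    have h1 := (hL i).dist_le_mul _ hri _ hti
    rw [hγd, abs_of_pos (sub_pos.2 hr.1)] at h1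
    have h2 := dist_triangle (u (γ r)) (u (γ t)) (u x)
    have h3 : dist (u (γ t)) (u x) ≤ L * (t * dist x y) := htS
    change dist (u (γ r)) (u x) ≤ L * (r * dist x y)
    linarith
  have h1 : (1 : ℝ) ∈ S := hsub ⟨zero_le_one, le_rfl⟩
  have h2 : dist (u (γ 1)) (u x) ≤ L * (1 * dist x y) := h1
  simpa [γ, dist_comm x y] using h2

namespace Triangulation

variable {d m : ℕ} {Ω : Set (E d)} {T : Triangulation d Ω} {s : Finset (E d)}

/-! ### Regularity of piecewise affine functions -/

theorem IsP1.continuousOn {u : E d → E m} (hu : T.IsP1 u) : ContinuousOn u (closure Ω) := by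
  have hcov : closure Ω = ⋃ s : T.elems, convexHull ℝ ((s : Finset (E d)) : Set (E d)) := by
    rw [← T.cover]
    ext x
    simp [mem_elems, elements]
  rw [hcov]
  refine (locallyFinite_of_finite _).continuousOn_iUnion
    (fun s => (isCompact_element _).isClosed) fun s => ?_
  obtain ⟨f, hf⟩ := hu s (mem_elems.1 s.2)
  exact f.continuous_of_finiteDimensional.continuousOn.congr hf

theorem continuous_Vh (hΩo : IsOpen Ω) (u : T.Vh m) : Continuous (u : E d → E m) := by
  have huniv : closure Ω ∪ Ωᶜ = Set.univ := Set.eq_univ_of_forall fun x => by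
    by_cases hx : x ∈ Ω
    · exact Or.inl (subset_closure hx)
    · exact Or.inr hx
  rw [← continuousOn_univ, ← huniv]
  exact (IsP1.continuousOn u.2.1).union_of_isClosed
    (continuousOn_const.congr fun x hx => u.2.2 x hx) isClosed_closure hΩo.isClosed_compl

/-- The elements together with the complement of `Ω` form a finite closed cover, and `u` is affine
or zero on each member. This gives bounded derivatives for integrability and permits integration by
parts on the whole space. -/
theorem exists_lipschitzWith_Vh (hΩo : IsOpen Ω) (u : T.Vh m) :
    ∃ L, LipschitzWith L (u : E d → E m) := by
  have hex : ∀ s : T.elems, ∃ L : NNReal, LipschitzOnWith L (u : E d → E m)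
      (convexHull ℝ ((s : Finset (E d)) : Set (E d))) := fun s => by
    obtain ⟨f, hf⟩ := u.2.1 s (mem_elems.1 s.2)
    refine ⟨‖LinearMap.toContinuousLinearMap f.linear‖₊, fun x hx y hy => ?_⟩
    rw [hf hx, hf hy, edist_eq_enorm_sub, edist_eq_enorm_sub, ← vsub_eq_sub, ← f.linearMap_vsub]
    exact (LinearMap.toContinuousLinearMap f.linear).le_opENorm (x - y)
  choose L hL using hex
  let A : Option T.elems → Set (E d) := fun o =>
    o.elim Ωᶜ fun s => convexHull ℝ ((s : Finset (E d)) : Set (E d))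
  refine ⟨Finset.univ.sup L, lipschitzWith_of_finite_closed_cover A ?_ ?_
    (continuous_Vh hΩo u) ?_⟩
  · rintro (_ | s)
    · exact hΩo.isClosed_compl
    · exact (isCompact_element _).isClosed
  · intro x
    by_cases hx : x ∈ Ω
    · obtain ⟨s, hs, hxs⟩ := exists_mem_element (T := T) (subset_closure hx)
      exact ⟨some ⟨s, mem_elems.2 hs⟩, hxs⟩
    · exact ⟨none, hx⟩
  · rintro (_ | s)
    · intro x hx y hy
      rw [u.2.2 x hx, u.2.2 y hy, edist_self]
      exact zero_le
    · exact (hL s).weaken (Finset.le_sup (Finset.mem_univ s))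

theorem hasFDerivAt_of_eqOn {u : E d → E m} {f : E d →ᵃ[ℝ] E m}
    (hf : Set.EqOn u f (convexHull ℝ (s : Set (E d)))) {x : E d} (hx : x ∈ cell s) :
    HasFDerivAt u (LinearMap.toContinuousLinearMap f.linear) x := by
  have h1 : HasFDerivAt f (LinearMap.toContinuousLinearMap f.linear) x := by
    have h := ((LinearMap.toContinuousLinearMap f.linear).hasFDerivAt (x := x)).add_const (f 0)
    rw [f.decomp]
    exact h
  refine h1.congr_of_eventuallyEq ?_
  filter_upwards [(isOpen_cell s).mem_nhds hx] with y hy using hf (cell_subset s hy)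

/-- The energy of an affine function on a simplex controls its values at the vertices. -/
theorem mass_bound (hs : s ∈ T.elements) {F : Type*} [NormedAddCommGroup F] [NormedSpace ℝ F]
    (f : E d →ᵃ[ℝ] F) :
    volume.real (cell s) * ∑ p ∈ s, ‖f p‖ ^ 2
      ≤ (d + 1) * 4 ^ (d + 1) * ∫ x in cell s, ‖f x‖ ^ 2 := by
  have hfin : volume (cell s) ≠ ⊤ :=
    ((isCompact_element s).measure_lt_top.trans_le' (measure_mono (cell_subset s))).ne
  have hne : s.Nonempty := by
    rw [← Finset.card_pos, hs.2]
    omega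
  obtain ⟨p, hp, hmax⟩ := s.exists_max_image (fun p => ‖f p‖) hne
  have hf : Continuous f := f.continuous_of_finiteDimensional
  have hint : IntegrableOn (fun x => ‖f x‖ ^ 2) (cell s) :=
    ((hf.norm.pow 2).continuousOn.integrableOn_compact (isCompact_element s)).mono_set
      (cell_subset s)
  -- The cell shrunk by `1/4` towards the vertex `p` of largest value. There `‖f‖ ≥ (3/4 - 1/4) ‖f
  -- p‖`, and the volume drops by `4 ^ d`; with the `d + 1` vertices this makes the constant `(d +
  -- 1) * 4 ^ (d + 1)`.
  let B : Set (E d) := AffineMap.homothety p (1 / 4 : ℝ) '' cell s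
  have hBv : volume.real B = (1 / 4) ^ d * volume.real (cell s) := by
    rw [measureReal_def, Measure.addHaar_image_homothety, ENNReal.toReal_mul,
      ENNReal.toReal_ofReal (abs_nonneg _), abs_of_nonneg (by positivity), ← measureReal_def]
    simp
  have hhom : ∀ y, AffineMap.homothety p (1 / 4 : ℝ) y = (1 / 4 : ℝ) • y + (3 / 4 : ℝ) • p := by
    intro y
    rw [AffineMap.homothety_apply]
    simp only [vsub_eq_sub, vadd_eq_add]
    module
  have hBsub : B ⊆ cell s := by
    rintro _ ⟨y, hy, rfl⟩
    rw [hhom]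
    exact (convex_convexHull ℝ _).combo_interior_self_mem_interior hy
      (subset_convexHull ℝ _ hp) (by norm_num) (by norm_num) (by norm_num)
  have hBopen : MeasurableSet B := by
    have h : IsOpen B := by
      refine AffineMap.homothety_isOpenMap p (1 / 4 : ℝ) (by norm_num) _ (isOpen_cell s)
    exact h.measurableSet
  have hlow : ∀ x ∈ B, ‖f p‖ ^ 2 / 4 ≤ ‖f x‖ ^ 2 := by
    rintro _ ⟨y, hy, rfl⟩
    have hy' := cell_subset s hy
    have hfy : ‖f y‖ ≤ ‖f p‖ := by
      rw [← sum_bary_smul hs f y]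
      refine (norm_sum_le _ _).trans ?_
      calc ∑ q ∈ s, ‖T.bary s q y • f q‖ ≤ ∑ q ∈ s, T.bary s q y * ‖f p‖ := by
            refine Finset.sum_le_sum fun q hq => ?_
            rw [norm_smul, Real.norm_of_nonneg (bary_nonneg hs hy' q)]
            exact mul_le_mul_of_nonneg_left (hmax q hq) (bary_nonneg hs hy' q)
        _ = ‖f p‖ := by rw [← Finset.sum_mul, sum_bary hs, one_mul]
    have hfx : f (AffineMap.homothety p (1 / 4 : ℝ) y) = (3 / 4 : ℝ) • f p + (1 / 4 : ℝ) • f y := by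
      rw [AffineMap.homothety_eq_lineMap, AffineMap.apply_lineMap, AffineMap.lineMap_apply_module]
      norm_num
    have h1 : ‖f p‖ / 2 ≤ ‖f (AffineMap.homothety p (1 / 4 : ℝ) y)‖ := by
      rw [hfx]
      have h := norm_sub_le ((3 / 4 : ℝ) • f p + (1 / 4 : ℝ) • f y) ((1 / 4 : ℝ) • f y)
      rw [add_sub_cancel_right, norm_smul, norm_smul] at h
      norm_num at h
      linarith
    have h0 := norm_nonneg (f p)
    nlinarith
  have h1 : volume.real B * (‖f p‖ ^ 2 / 4) ≤ ∫ x in cell s, ‖f x‖ ^ 2 := by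
    calc volume.real B * (‖f p‖ ^ 2 / 4) = ∫ _ in B, ‖f p‖ ^ 2 / 4 := by
          rw [setIntegral_const, smul_eq_mul]
      _ ≤ ∫ x in B, ‖f x‖ ^ 2 := by
          refine setIntegral_mono_on ?_ (hint.mono_set hBsub) hBopen hlow
          exact integrableOn_const (measure_ne_top_of_subset hBsub hfin)
      _ ≤ ∫ x in cell s, ‖f x‖ ^ 2 :=
          setIntegral_mono_set hint (Filter.Eventually.of_forall fun x => by positivity)
            hBsub.eventuallyLE
  have h2 : ∑ q ∈ s, ‖f q‖ ^ 2 ≤ (d + 1) * ‖f p‖ ^ 2 := by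
    have h := Finset.sum_le_card_nsmul s (fun q => ‖f q‖ ^ 2) (‖f p‖ ^ 2) fun q hq =>
      pow_le_pow_left₀ (norm_nonneg _) (hmax q hq) 2
    rw [hs.2, nsmul_eq_mul] at h
    exact_mod_cast h
  calc volume.real (cell s) * ∑ q ∈ s, ‖f q‖ ^ 2
      ≤ volume.real (cell s) * ((d + 1) * ‖f p‖ ^ 2) :=
        mul_le_mul_of_nonneg_left h2 measureReal_nonneg
    _ = (d + 1) * 4 ^ (d + 1) * (volume.real B * (‖f p‖ ^ 2 / 4)) := by
        rw [hBv]
        have h4 : (4 : ℝ) ^ d * (1 / 4) ^ d = 1 := by rw [← mul_pow]; norm_num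
        rw [pow_succ]
        linear_combination (-(d + 1) * volume.real (cell s) * ‖f p‖ ^ 2) * h4
    _ ≤ _ := mul_le_mul_of_nonneg_left h1 (by positivity)

/-! ### Integrability -/

theorem integrableOn_of_continuousOn (hΩb : Bornology.IsBounded Ω) {f : E d → ℝ}
    (hf : ContinuousOn f (closure Ω)) : IntegrableOn f Ω :=
  (hf.integrableOn_compact hΩb.isCompact_closure).mono_set subset_closure

theorem integrableOn_inner (hΩo : IsOpen Ω) (hΩb : Bornology.IsBounded Ω) (u v : T.Vh m) :
    IntegrableOn (fun x => inner ℝ ((u : E d → E m) x) ((v : E d → E m) x)) Ω :=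
  integrableOn_of_continuousOn hΩb
    ((continuous_Vh hΩo u).inner (𝕜 := ℝ) (continuous_Vh hΩo v)).continuousOn

theorem integrableOn_director (hΩo : IsOpen Ω) (hΩb : Bornology.IsBounded Ω) {n : E d → E m}
    (hn : T.IsP1 n) (u v : T.Vh m) :
    IntegrableOn (fun x => inner ℝ (n x) ((u : E d → E m) x) *
      inner ℝ (n x) ((v : E d → E m) x)) Ω :=
  integrableOn_of_continuousOn hΩb
    ((hn.continuousOn.inner (𝕜 := ℝ) (continuous_Vh hΩo u).continuousOn).mul
      (hn.continuousOn.inner (𝕜 := ℝ) (continuous_Vh hΩo v).continuousOn))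

theorem integrableOn_weight (hΩb : Bornology.IsBounded Ω) {lam : E d → ℝ}
    (hlam : MemLp lam 2 (volume.restrict Ω)) : IntegrableOn lam Ω := by
  have : IsFiniteMeasure (volume.restrict Ω) := ⟨by
    rw [Measure.restrict_apply_univ]; exact hΩb.measure_lt_top⟩
  exact hlam.integrable (by norm_num)

theorem integrableOn_weight_inner (hΩo : IsOpen Ω) (hΩb : Bornology.IsBounded Ω) {lam : E d → ℝ}
    (hlam : MemLp lam 2 (volume.restrict Ω)) (u v : T.Vh m) :
    IntegrableOn (fun x => lam x * inner ℝ ((u : E d → E m) x) ((v : E d → E m) x)) Ω := by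
  have hc : Continuous fun x => inner ℝ ((u : E d → E m) x) ((v : E d → E m) x) :=
    (continuous_Vh hΩo u).inner (𝕜 := ℝ) (continuous_Vh hΩo v)
  obtain ⟨M, hM⟩ := hΩb.isCompact_closure.exists_bound_of_continuousOn hc.continuousOn
  exact (integrableOn_weight hΩb hlam).mul_bdd (c := M) hc.aestronglyMeasurable
    (ae_restrict_of_forall_mem hΩo.measurableSet fun x hx => hM x (subset_closure hx))

theorem integrableOn_grad (hΩo : IsOpen Ω) (hΩb : Bornology.IsBounded Ω) (u v : T.Vh m) :
    IntegrableOn (fun x => ∑ j : Fin d,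
      inner ℝ (fderiv ℝ (u : E d → E m) x (EuclideanSpace.single j 1))
        (fderiv ℝ (v : E d → E m) x (EuclideanSpace.single j 1))) Ω := by
  obtain ⟨L, hL⟩ := exists_lipschitzWith_Vh hΩo u
  obtain ⟨L', hL'⟩ := exists_lipschitzWith_Vh hΩo v
  refine integrable_finsetSum _ fun j _ => ?_
  refine Measure.integrableOn_of_bounded (M := L * L') hΩb.measure_lt_top.ne ?_
    (Filter.Eventually.of_forall fun x => ?_)
  · exact ((measurable_fderiv_apply_const ℝ _ _).inner
      (measurable_fderiv_apply_const ℝ _ _)).aestronglyMeasurable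
  · have h : ∀ {w : E d → E m} {K : NNReal}, LipschitzWith K w →
        ‖fderiv ℝ w x (EuclideanSpace.single j 1)‖ ≤ K := fun {w K} hw => by
      refine ((fderiv ℝ w x).le_opNorm _).trans ?_
      have h1 := norm_fderiv_le_of_lipschitz ℝ hw (x₀ := x)
      simpa using h1
    exact (norm_inner_le_norm _ _).trans
      (mul_le_mul (h hL) (h hL') (norm_nonneg _) L.coe_nonneg)

/-! ### The bilinear form -/

theorem ae_differentiableAt (hΩ : interior (closure Ω) = Ω) (u : T.Vh m) :
    ∀ᵐ x ∂(volume.restrict Ω), DifferentiableAt ℝ (u : E d → E m) x := by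
  filter_upwards [T.ae_mem_cell hΩ] with x hx
  obtain ⟨s, hs, hxs⟩ := hx
  obtain ⟨f, hf⟩ := u.2.1 s hs
  exact (hasFDerivAt_of_eqOn hf hxs).differentiableAt

theorem gradL2_add_left (hΩo : IsOpen Ω) (hΩb : Bornology.IsBounded Ω)
    (hΩ : interior (closure Ω) = Ω) (u u' v : T.Vh m) :
    gradL2 Ω (u + u' : T.Vh m).1 v.1 = gradL2 Ω u.1 v.1 + gradL2 Ω u'.1 v.1 := by
  unfold gradL2
  rw [← integral_add (integrableOn_grad hΩo hΩb u v) (integrableOn_grad hΩo hΩb u' v)]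
  refine integral_congr_ae ?_
  filter_upwards [ae_differentiableAt hΩ u, ae_differentiableAt hΩ u'] with x hx hx'
  have h : fderiv ℝ (u + u' : T.Vh m).1 x = fderiv ℝ u.1 x + fderiv ℝ u'.1 x := fderiv_add hx hx'
  rw [h, ← Finset.sum_add_distrib]
  exact Finset.sum_congr rfl fun j _ => by rw [add_apply, inner_add_left]

theorem gradL2_smul_left (hΩ : interior (closure Ω) = Ω) (c : ℝ) (u v : T.Vh m) :
    gradL2 Ω (c • u : T.Vh m).1 v.1 = c * gradL2 Ω u.1 v.1 := by
  unfold gradL2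
  rw [← integral_const_mul]
  refine integral_congr_ae ?_
  filter_upwards [ae_differentiableAt hΩ u] with x hx
  have h : fderiv ℝ (c • u : T.Vh m).1 x = c • fderiv ℝ u.1 x := fderiv_const_smul hx c
  rw [h, Finset.mul_sum]
  exact Finset.sum_congr rfl fun j _ => by
    rw [smul_apply, real_inner_smul_left]

theorem aForm_comm (Ω : Set (E d)) (K γ : ℝ) (lam : E d → ℝ) (n u v : E d → E m) :
    aForm Ω K γ lam n u v = aForm Ω K γ lam n v u := by
  unfold aForm gradL2
  simp only [real_inner_comm, mul_comm]

/-- The form `aForm` on the finite element space as a bilinear map. -/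
theorem exists_bilinear_aForm (hΩo : IsOpen Ω) (hΩb : Bornology.IsBounded Ω)
    (hΩ : interior (closure Ω) = Ω) (K γ : ℝ) {lam : E d → ℝ}
    (hlam : MemLp lam 2 (volume.restrict Ω)) {n : E d → E m} (hn : T.IsP1 n) :
    ∃ B : T.Vh m →ₗ[ℝ] T.Vh m →ₗ[ℝ] ℝ, ∀ u v, B u v = aForm Ω K γ lam n u.1 v.1 := by
  have hadd : ∀ u u' v : T.Vh m, aForm Ω K γ lam n (u + u' : T.Vh m).1 v.1
      = aForm Ω K γ lam n u.1 v.1 + aForm Ω K γ lam n u'.1 v.1 := fun u u' v => by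
    unfold aForm
    rw [gradL2_add_left hΩo hΩb hΩ]
    have h1 : ∫ x in Ω, lam x * inner ℝ ((u + u' : T.Vh m).1 x) (v.1 x)
        = (∫ x in Ω, lam x * inner ℝ (u.1 x) (v.1 x))
          + ∫ x in Ω, lam x * inner ℝ (u'.1 x) (v.1 x) := by
      rw [← integral_add (integrableOn_weight_inner hΩo hΩb hlam u v)
        (integrableOn_weight_inner hΩo hΩb hlam u' v)]
      refine integral_congr_ae (Filter.Eventually.of_forall fun x => ?_)
      simp only [Submodule.coe_add, Pi.add_apply, inner_add_left]
      ring
    have h2 : ∫ x in Ω, inner ℝ (n x) ((u + u' : T.Vh m).1 x) * inner ℝ (n x) (v.1 x)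
        = (∫ x in Ω, inner ℝ (n x) (u.1 x) * inner ℝ (n x) (v.1 x))
          + ∫ x in Ω, inner ℝ (n x) (u'.1 x) * inner ℝ (n x) (v.1 x) := by
      rw [← integral_add (integrableOn_director hΩo hΩb hn u v)
        (integrableOn_director hΩo hΩb hn u' v)]
      refine integral_congr_ae (Filter.Eventually.of_forall fun x => ?_)
      simp only [Submodule.coe_add, Pi.add_apply, inner_add_right]
      ring
    rw [h1, h2]
    ring
  have hsmul : ∀ (c : ℝ) (u v : T.Vh m), aForm Ω K γ lam n (c • u : T.Vh m).1 v.1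
      = c * aForm Ω K γ lam n u.1 v.1 := fun c u v => by
    unfold aForm
    rw [gradL2_smul_left hΩ]
    have h1 : ∫ x in Ω, lam x * inner ℝ ((c • u : T.Vh m).1 x) (v.1 x)
        = c * ∫ x in Ω, lam x * inner ℝ (u.1 x) (v.1 x) := by
      rw [← integral_const_mul]
      refine integral_congr_ae (Filter.Eventually.of_forall fun x => ?_)
      simp only [Submodule.coe_smul, Pi.smul_apply, real_inner_smul_left]
      ring
    have h2 : ∫ x in Ω, inner ℝ (n x) ((c • u : T.Vh m).1 x) * inner ℝ (n x) (v.1 x)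
        = c * ∫ x in Ω, inner ℝ (n x) (u.1 x) * inner ℝ (n x) (v.1 x) := by
      rw [← integral_const_mul]
      refine integral_congr_ae (Filter.Eventually.of_forall fun x => ?_)
      simp only [Submodule.coe_smul, Pi.smul_apply, real_inner_smul_right]
      ring
    rw [h1, h2]
    ring
  refine ⟨LinearMap.mk₂ ℝ (fun u v : T.Vh m => aForm Ω K γ lam n u.1 v.1) hadd
    (fun c u v => hsmul c u v) (fun u v v' => ?_) (fun c u v => ?_), fun u v => rfl⟩
  · rw [aForm_comm, hadd, aForm_comm _ _ _ _ _ v.1, aForm_comm _ _ _ _ _ v'.1]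
  · rw [aForm_comm, hsmul, aForm_comm _ _ _ _ _ v.1, smul_eq_mul]

theorem fderiv_of_notMem_tsupport {u : E d → E m} {x : E d} (hx : x ∉ tsupport u) :
    fderiv ℝ u x = 0 :=
  image_eq_zero_of_notMem_tsupport fun h => hx (tsupport_fderiv_subset ℝ h)

/-- Functions whose supports intersect in a null set are orthogonal. -/
theorem aForm_eq_zero_of_measure_inter (Ω : Set (E d)) (K γ : ℝ) (lam : E d → ℝ)
    (n u v : E d → E m) (h : volume (tsupport u ∩ tsupport v) = 0) :
    aForm Ω K γ lam n u v = 0 := by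
  have hae : ∀ᵐ x ∂(volume.restrict Ω), x ∉ tsupport u ∩ tsupport v :=
    ae_restrict_of_ae (measure_eq_zero_iff_ae_notMem.1 h)
  have hor : ∀ x ∉ tsupport u ∩ tsupport v, x ∉ tsupport u ∨ x ∉ tsupport v := fun x hx => by
    by_contra! hcon
    exact hx hcon
  have h1 : gradL2 Ω u v = 0 := by
    refine integral_eq_zero_of_ae ?_
    filter_upwards [hae] with x hx
    refine Finset.sum_eq_zero fun j _ => ?_
    rcases hor x hx with hx | hx <;> simp [fderiv_of_notMem_tsupport hx]
  have h2 : ∫ x in Ω, lam x * inner ℝ (u x) (v x) = 0 := by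
    refine integral_eq_zero_of_ae ?_
    filter_upwards [hae] with x hx
    rcases hor x hx with hx | hx <;> simp [image_eq_zero_of_notMem_tsupport hx]
  have h3 : ∫ x in Ω, inner ℝ (n x) (u x) * inner ℝ (n x) (v x) = 0 := by
    refine integral_eq_zero_of_ae ?_
    filter_upwards [hae] with x hx
    rcases hor x hx with hx | hx <;> simp [image_eq_zero_of_notMem_tsupport hx]
  rw [aForm, h1, h2, h3]
  ring

/-! ### The Poincaré inequality -/

/-- The Poincaré–Friedrichs inequality for finite element functions vanishing on the boundary. -/
theorem poincare (hd : 0 < d) (hΩo : IsOpen Ω) (hΩb : Bornology.IsBounded Ω)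
    (hΩ : interior (closure Ω) = Ω) {R : ℝ} (hR : ∀ x ∈ Ω, ‖x‖ ≤ R) (u : T.Vh m) :
    l2 Ω u.1 u.1 ≤ 4 * R ^ 2 * gradL2 Ω u.1 u.1 := by
  obtain ⟨L, hL⟩ := exists_lipschitzWith_Vh hΩo u
  let j : Fin d := ⟨0, hd⟩
  let e : E d := EuclideanSpace.single j 1
  let w : E d → E m := u.1
  have hw0 : ∀ x ∉ Ω, w x = 0 := u.2.2
  have hsupp : HasCompactSupport w := by
    refine HasCompactSupport.intro hΩb.isCompact_closure fun x hx => hw0 x fun h => ?_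
    exact hx (subset_closure h)
  obtain ⟨M, hM⟩ := hL.continuous.bounded_above_of_compact_support hsupp
  have hM0 : 0 ≤ M := (norm_nonneg _).trans (hM 0)
  lift M to NNReal using hM0
  let g : E d → ℝ := fun x => inner ℝ (w x) (w x)
  have hgL : LipschitzWith (2 * M * L) g := by
    refine LipschitzWith.of_dist_le_mul fun x y => ?_
    have h1 : g x - g y = inner ℝ (w x - w y) (w x + w y) := by
      simp only [g, inner_sub_left, inner_add_right, real_inner_comm (w x) (w y)]
      ring
    have h2 := hL.dist_le_mul x y
    rw [dist_eq_norm (w x)] at h2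
    rw [Real.dist_eq, h1]
    refine (abs_real_inner_le_norm _ _).trans ?_
    have h3 : ‖w x + w y‖ ≤ 2 * M := (norm_add_le _ _).trans (by linarith [hM x, hM y])
    calc ‖w x - w y‖ * ‖w x + w y‖ ≤ (L * dist x y) * (2 * M) :=
          mul_le_mul h2 h3 (norm_nonneg _) (by positivity)
      _ = _ := by push_cast; ring
  have hgsupp : HasCompactSupport g := by
    refine HasCompactSupport.intro hΩb.isCompact_closure fun x hx => ?_
    simp only [g]
    rw [hw0 x fun h => hx (subset_closure h), inner_zero_left]
  -- Since `∂_j x_j = 1`, integrating `‖w‖²` by parts against the coordinate function gives `-∫ x_j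
  -- ∂_j ‖w‖²`, with `|x_j| ≤ R` on `Ω`.
  let f : E d → ℝ := fun x => x j
  have hf : LipschitzWith 1 f := LipschitzWith.of_dist_le_mul fun x y => by
    rw [Real.dist_eq, dist_eq_norm]
    have h1 := PiLp.norm_apply_le (x - y) j
    simpa using h1
  have hparts := LipschitzWith.integral_lineDeriv_mul_eq (μ := (volume : Measure (E d))) hf hgL hgsupp e
  have hfd : ∀ x, lineDeriv ℝ f x e = 1 := fun x => by
    have h : HasFDerivAt f (EuclideanSpace.proj j : E d →L[ℝ] ℝ) x :=
      (EuclideanSpace.proj j : E d →L[ℝ] ℝ).hasFDerivAt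
    rw [h.hasLineDerivAt e |>.lineDeriv]
    simp [e]
  have hgd : ∀ x, DifferentiableAt ℝ w x →
      lineDeriv ℝ g x (-e) = -(2 * inner ℝ (w x) (fderiv ℝ w x e)) := fun x hx => by
    have h := hx.hasFDerivAt.inner ℝ hx.hasFDerivAt
    rw [h.hasLineDerivAt (-e) |>.lineDeriv]
    simp [real_inner_comm]
    ring
  have hl : ∫ x, lineDeriv ℝ f x e * g x = l2 Ω u.1 u.1 := by
    simp only [hfd, one_mul]
    exact (setIntegral_eq_integral_of_forall_compl_eq_zero fun x hx => by
      simp only [g]; rw [hw0 x hx, inner_zero_left]).symm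
  have hr : ∫ x, lineDeriv ℝ g x (-e) * f x
      ≤ ∫ x in Ω, (1 / 2 * inner ℝ (w x) (w x) + 2 * R ^ 2 * ∑ i : Fin d,
          inner ℝ (fderiv ℝ w x (EuclideanSpace.single i 1))
            (fderiv ℝ w x (EuclideanSpace.single i 1))) := by
    -- Off `Ω` the nonnegative function `g` attains its minimum `0`, so the line derivative vanishes
    -- there, boundary points included, without any differentiability argument.
    have hmin : ∀ x ∉ Ω, lineDeriv ℝ g x (-e) * f x = 0 := fun x hx => by
      have h : IsLocalMin (fun t : ℝ => g (x + t • -e)) 0 := by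
        refine Filter.Eventually.of_forall fun t => ?_
        simp only [g, zero_smul, add_zero]
        rw [hw0 x hx, inner_zero_left]
        exact real_inner_self_nonneg
      rw [lineDeriv, h.deriv_eq_zero, zero_mul]
    rw [← setIntegral_eq_integral_of_forall_compl_eq_zero hmin]
    have hlin : AEStronglyMeasurable (fun x => lineDeriv ℝ g x (-e)) (volume.restrict Ω) :=
      (hgL.memLp_lineDeriv (μ := volume) (-e)).aestronglyMeasurable.restrict
    have hfint : IntegrableOn f Ω := integrableOn_of_continuousOn hΩb hf.continuous.continuousOn
    refine setIntegral_mono_ae_restrict (hfint.bdd_mul hlin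
      (Filter.Eventually.of_forall fun x => norm_lineDeriv_le_of_lipschitz ℝ hgL))
      (((integrableOn_inner hΩo hΩb u u).const_mul _).add
        ((integrableOn_grad hΩo hΩb u u).const_mul _)) ?_
    filter_upwards [ae_differentiableAt hΩ u, ae_restrict_mem hΩo.measurableSet]
      with x hx hxΩ
    rw [hgd x hx]
    have hsum : inner ℝ (fderiv ℝ w x e) (fderiv ℝ w x e) ≤ ∑ i : Fin d,
        inner ℝ (fderiv ℝ w x (EuclideanSpace.single i 1))
          (fderiv ℝ w x (EuclideanSpace.single i 1)) :=
      Finset.single_le_sum (f := fun i : Fin d =>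
        inner ℝ (fderiv ℝ w x (EuclideanSpace.single i 1))
          (fderiv ℝ w x (EuclideanSpace.single i 1)))
        (fun i _ => real_inner_self_nonneg) (Finset.mem_univ j)
    rw [real_inner_self_eq_norm_sq] at hsum
    have hxj : |x j| ≤ R := (PiLp.norm_apply_le x j).trans (hR x hxΩ)
    have hin := abs_real_inner_le_norm (w x) (fderiv ℝ w x e)
    have hprod : -(2 * inner ℝ (w x) (fderiv ℝ w x e)) * x j
        ≤ 2 * (‖w x‖ * ‖fderiv ℝ w x e‖) * R := by
      refine (le_abs_self _).trans ?_
      rw [abs_mul, abs_neg, abs_mul, abs_two]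
      gcongr
    -- Young's inequality weighted so that half of the `L²` norm can be absorbed on the left.
    have hsq : 2 * (‖w x‖ * ‖fderiv ℝ w x e‖) * R
        ≤ 1 / 2 * ‖w x‖ ^ 2 + 2 * R ^ 2 * ‖fderiv ℝ w x e‖ ^ 2 := by
      nlinarith [sq_nonneg (‖w x‖ - 2 * R * ‖fderiv ℝ w x e‖)]
    have hmul := mul_le_mul_of_nonneg_left hsum (by positivity : (0 : ℝ) ≤ 2 * R ^ 2)
    rw [real_inner_self_eq_norm_sq (w x)]
    exact hprod.trans (hsq.trans (by linarith))
  rw [hparts] at hl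
  rw [hl, integral_add ((integrableOn_inner hΩo hΩb u u).const_mul _)
    ((integrableOn_grad hΩo hΩb u u).const_mul _), integral_const_mul, integral_const_mul] at hr
  change l2 Ω u.1 u.1 ≤ 1 / 2 * l2 Ω u.1 u.1 + 2 * R ^ 2 * gradL2 Ω u.1 u.1 at hr
  linarith

/-! ### Estimates on a single element -/

theorem measure_cell_ne_top (s : Finset (E d)) : volume (cell s) ≠ ⊤ :=
  ((isCompact_element s).measure_lt_top.trans_le' (measure_mono (cell_subset s))).ne

theorem cell_nonempty (hs : s ∈ T.elements) : (cell s).Nonempty := by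
  rw [cell, ← range_elementBasis hs]
  exact ⟨_, (T.elementBasis hs).centroid_mem_interior_convexHull⟩

theorem measure_cell_pos (hs : s ∈ T.elements) : 0 < volume (cell s) :=
  (isOpen_cell s).measure_pos volume (cell_nonempty hs)

/-- A step of length `r` from the centre of the ball stays in the element, where the coordinate
ranges over `[0, 1]`; it therefore changes by at most one. -/
theorem abs_linear_bary_le (hs : s ∈ T.elements) {c : E d} {r : ℝ} (hr : 0 < r)
    (hball : Metric.closedBall c r ⊆ convexHull ℝ (s : Set (E d))) (p v : E d) :
    |(T.bary s p).linear v| ≤ ‖v‖ / r := by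
  rcases eq_or_ne v 0 with rfl | hv
  · simp
  have hv' : 0 < ‖v‖ := norm_pos_iff.2 hv
  have hc := hball (Metric.mem_closedBall_self hr.le)
  have hy : (r / ‖v‖) • v + c ∈ convexHull ℝ (s : Set (E d)) := by
    apply hball
    rw [Metric.mem_closedBall, dist_eq_norm, add_sub_cancel_right, norm_smul, Real.norm_of_nonneg
      (by positivity), div_mul_cancel₀ _ hv'.ne']
  have h := (T.bary s p).map_vadd c ((r / ‖v‖) • v)
  simp only [vadd_eq_add, map_smul, smul_eq_mul] at h
  have h1 := bary_nonneg hs hc p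
  have h2 := bary_le_one hs hc p
  have h3 := bary_nonneg hs hy p
  have h4 := bary_le_one hs hy p
  have h5 : |r / ‖v‖ * (T.bary s p).linear v| ≤ 1 := by
    rw [abs_le]
    constructor <;> linarith
  rw [abs_mul, abs_of_pos (by positivity), div_mul_eq_mul_div, div_le_one hv'] at h5
  rw [le_div_iff₀ hr]
  linarith

/-- On each element, a piecewise affine function is Lipschitz with constant the essential supremum
of its Jacobian. -/
theorem norm_sub_le_jacobianSup (hΩ : interior (closure Ω) = Ω) {n : E d → E m} (hn : T.IsP1 n)
    (hs : s ∈ T.elements) {x y : E d} (hx : x ∈ convexHull ℝ (s : Set (E d)))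
    (hy : y ∈ convexHull ℝ (s : Set (E d))) : ‖n x - n y‖ ≤ jacobianSup Ω n * ‖x - y‖ := by
  classical
  choose f hf using hn
  -- Finiteness is essential: `toReal` would turn an infinite supremum into `0`. It holds because
  -- finitely many affine pieces have finitely many Jacobians.
  have hfin : eLpNorm (fun x => fderiv ℝ n x) ⊤ (volume.restrict Ω) ≠ ⊤ := by
    have hex : ∀ t : T.elems, ∃ M : ℝ, ∀ z ∈ cell (t : Finset (E d)), ‖fderiv ℝ n z‖ ≤ M :=
      fun t => ⟨_, fun z hz => by
        rw [(hasFDerivAt_of_eqOn (hf t (mem_elems.1 t.2)) hz).fderiv]⟩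
    choose M hM' using hex
    have hM : ∀ᵐ x ∂(volume.restrict Ω), ‖fderiv ℝ n x‖ ≤ ∑ t, |M t| := by
      filter_upwards [T.ae_mem_cell hΩ] with z hz
      obtain ⟨t, ht, hzt⟩ := hz
      refine (hM' ⟨t, mem_elems.2 ht⟩ z hzt).trans ((le_abs_self _).trans ?_)
      exact Finset.single_le_sum (f := fun t => |M t|) (fun _ _ => abs_nonneg _)
        (Finset.mem_univ _)
    rw [eLpNorm_exponent_top]
    exact ((eLpNormEssSup_le_of_ae_bound hM).trans_lt ENNReal.ofReal_lt_top).ne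
  have hae : ∀ᵐ x ∂(volume.restrict Ω), ‖fderiv ℝ n x‖ ≤ jacobianSup Ω n := by
    have h : ∀ᵐ x ∂(volume.restrict Ω), ‖fderiv ℝ n x‖ₑ
        ≤ eLpNorm (fun x => fderiv ℝ n x) ⊤ (volume.restrict Ω) := by
      rw [eLpNorm_exponent_top]
      exact ae_le_eLpNormEssSup
    filter_upwards [h] with z hz
    have h1 := ENNReal.toReal_mono hfin hz
    rwa [toReal_enorm] at h1
  have hae' := ae_restrict_of_ae_restrict_of_subset (cell_subset_domain hΩ hs) hae
  -- The Jacobian is constant on the cell, which has positive measure, so one point satisfying the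
  -- almost-everywhere bound is enough.
  obtain ⟨z, hz, hzs⟩ : ∃ z, ‖fderiv ℝ n z‖ ≤ jacobianSup Ω n ∧ z ∈ cell s := by
    have : (ae (volume.restrict (cell s))).NeBot := by
      rw [ae_neBot, Ne, Measure.restrict_eq_zero]
      exact (measure_cell_pos hs).ne'
    exact (hae'.and (ae_restrict_mem (isOpen_cell s).measurableSet)).exists
  rw [(hasFDerivAt_of_eqOn (hf s hs) hzs).fderiv] at hz
  rw [hf s hs hx, hf s hs hy, ← vsub_eq_sub, ← (f s hs).linearMap_vsub]
  exact ((LinearMap.toContinuousLinearMap (f s hs).linear).le_opNorm (x - y)).trans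
    (mul_le_mul_of_nonneg_right hz (norm_nonneg _))

theorem setIntegral_cell_le {f : E d → ℝ} (hf : IntegrableOn f (cell s)) {c : ℝ}
    (h : ∀ x ∈ cell s, f x ≤ c) : ∫ x in cell s, f x ≤ volume.real (cell s) * c := by
  calc ∫ x in cell s, f x ≤ ∫ _ in cell s, c :=
        setIntegral_mono_on hf (integrableOn_const (measure_cell_ne_top s))
          (isOpen_cell s).measurableSet h
    _ = volume.real (cell s) * c := by rw [setIntegral_const, smul_eq_mul]

/-- Hölder's inequality against the constant one on the cell. The absolute value is there because
`Λ` carries no sign assumption. -/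
theorem integral_cell_weight_le (hΩ : interior (closure Ω) = Ω) (hs : s ∈ T.elements)
    {lam : E d → ℝ} (hlam : MemLp lam 2 (volume.restrict Ω))
    (hpos : ∀ᵐ x ∂(volume.restrict Ω), 0 ≤ lam x) {Λ : ℝ}
    (hΛ : eLpNorm lam 2 (volume.restrict Ω) ≤ ENNReal.ofReal Λ) :
    ∫ x in cell s, lam x ≤ |Λ| * √(volume.real (cell s)) := by
  have hsub := cell_subset_domain hΩ hs
  have hm : AEStronglyMeasurable lam (volume.restrict (cell s)) :=
    hlam.aestronglyMeasurable.mono_measure (Measure.restrict_mono hsub le_rfl)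
  have hpos' := ae_restrict_of_ae_restrict_of_subset hsub hpos
  have h1 := eLpNorm_le_eLpNorm_mul_rpow_measure_univ (p := 1) (q := 2) (by norm_num) hm
  have h2 : eLpNorm lam 2 (volume.restrict (cell s)) ≤ ENNReal.ofReal |Λ| :=
    (eLpNorm_mono_measure _ (Measure.restrict_mono hsub le_rfl)).trans
      (hΛ.trans (ENNReal.ofReal_le_ofReal (le_abs_self Λ)))
  have h3 : (volume.restrict (cell s)) Set.univ ^ (1 / (1 : ENNReal).toReal - 1 / (2 : ENNReal).toReal)
      = ENNReal.ofReal √(volume.real (cell s)) := by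
    rw [Measure.restrict_apply_univ, Real.sqrt_eq_rpow, ← ENNReal.ofReal_rpow_of_nonneg
      measureReal_nonneg (by norm_num), measureReal_def,
      ENNReal.ofReal_toReal (measure_cell_ne_top s)]
    norm_num
  rw [h3] at h1
  have h4 := h1.trans (mul_le_mul_left h2 _)
  rw [← ENNReal.ofReal_mul (abs_nonneg Λ)] at h4
  rw [integral_eq_lintegral_of_nonneg_ae hpos' hm]
  refine ENNReal.toReal_le_of_le_ofReal (by positivity) (le_trans (le_of_eq ?_) h4)
  rw [eLpNorm_one_eq_lintegral_enorm]
  refine lintegral_congr_ae ?_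
  filter_upwards [hpos'] with x hx
  rw [← ofReal_norm, Real.norm_of_nonneg hx]

/-- The square of a convex combination is at most the sum of the squares. -/
theorem sq_sum_bary_mul_le (hs : s ∈ T.elements) {x : E d}
    (hx : x ∈ convexHull ℝ (s : Set (E d))) (a : E d → ℝ) :
    (∑ p ∈ s, T.bary s p x * a p) ^ 2 ≤ ∑ p ∈ s, a p ^ 2 := by
  have h := (even_two.convexOn_pow (𝕜 := ℝ)).map_sum_le (t := s) (w := fun p => T.bary s p x)
    (p := a) (fun p _ => bary_nonneg hs hx p) (sum_bary hs x) fun _ _ => Set.mem_univ _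
  simp only [smul_eq_mul] at h
  refine h.trans (Finset.sum_le_sum fun p _ => ?_)
  exact mul_le_of_le_one_left (sq_nonneg _) (bary_le_one hs hx p)

/-! ### Sums over the vertices -/

variable (T) in
/-- The mesh-dependent `L²` norm squared, computed from the values at the vertices. -/
def vertexSq {F : Type*} [Norm F] (g : E d → F) : ℝ :=
  ∑ s ∈ T.elems, volume.real (cell s) * ∑ p ∈ s, ‖g p‖ ^ 2

theorem vertexSq_nonneg {F : Type*} [NormedAddCommGroup F] (g : E d → F) : 0 ≤ T.vertexSq g :=
  Finset.sum_nonneg fun _ _ => mul_nonneg measureReal_nonneg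
    (Finset.sum_nonneg fun _ _ => sq_nonneg _)

theorem vertexSq_le (hΩo : IsOpen Ω) (hΩb : Bornology.IsBounded Ω)
    (hΩ : interior (closure Ω) = Ω) (u : T.Vh m) :
    T.vertexSq u.1 ≤ (d + 1) * 4 ^ (d + 1) * l2 Ω u.1 u.1 := by
  rw [l2, integral_eq_sum_cell T hΩ (integrableOn_inner hΩo hΩb u u), Finset.mul_sum]
  refine Finset.sum_le_sum fun s hs => ?_
  obtain ⟨f, hf⟩ := u.2.1 s (mem_elems.1 hs)
  have h := mass_bound (mem_elems.1 hs) f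
  have h1 : ∑ p ∈ s, ‖(u : E d → E m) p‖ ^ 2 = ∑ p ∈ s, ‖f p‖ ^ 2 :=
    Finset.sum_congr rfl fun p hp => by rw [hf (subset_convexHull ℝ _ hp)]
  have h2 : ∫ x in cell s, inner ℝ (u.1 x) (u.1 x) = ∫ x in cell s, ‖f x‖ ^ 2 :=
    setIntegral_congr_fun (isOpen_cell s).measurableSet fun x hx => by
      rw [real_inner_self_eq_norm_sq, hf (cell_subset s hx)]
  rw [h1, h2]
  exact h

/-- Integrals of functions that live on the stars of the vertices are estimated elementwise. -/
theorem sum_vertex_integral_le (hΩ : interior (closure Ω) = Ω) (F : E d → E d → ℝ)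
    (hF : ∀ p, IntegrableOn (F p) Ω)
    (h0 : ∀ s ∈ T.elements, ∀ p ∉ s, ∀ x ∈ cell s, F p x = 0)
    (b : Finset (E d) → E d → ℝ)
    (hb : ∀ s ∈ T.elements, ∀ p ∈ s, ∫ x in cell s, F p x ≤ b s p) :
    ∑ p : T.Vertex, ∫ x in Ω, F p x ≤ ∑ s ∈ T.elems, ∑ p ∈ s, b s p := by
  have h1 : ∀ p : T.Vertex, ∫ x in Ω, F p x = ∑ s ∈ T.elems, ∫ x in cell s, F p x := fun p =>
    integral_eq_sum_cell T hΩ (hF p)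
  simp only [h1]
  rw [Finset.sum_comm]
  refine Finset.sum_le_sum fun s hs => ?_
  rw [mem_elems] at hs
  rw [sum_vertex_eq hs (fun p => ∫ x in cell s, F p x) fun p hp =>
    setIntegral_eq_zero_of_forall_eq_zero (h0 s hs p hp)]
  exact Finset.sum_le_sum (hb s hs)

theorem nodal_eq_on_element (hΩo : IsOpen Ω) (hΩ : interior (closure Ω) = Ω)
    (hs : s ∈ T.elements) (u : T.Vh m) (p : E d) {x : E d}
    (hx : x ∈ convexHull ℝ (s : Set (E d))) :
    (nodal hΩo hΩ u p).1 x = T.bary s p x • u.1 p := by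
  rw [← hat_eq_bary hs hx]
  rfl

theorem fderiv_nodal (hΩo : IsOpen Ω) (hΩ : interior (closure Ω) = Ω) (hs : s ∈ T.elements)
    (u : T.Vh m) (p : E d) {x : E d} (hx : x ∈ cell s) (v : E d) :
    fderiv ℝ (nodal hΩo hΩ u p).1 x v = (T.bary s p).linear v • u.1 p := by
  let f : E d →ᵃ[ℝ] E m :=
    (LinearMap.toSpanSingleton ℝ (E m) (u.1 p)).toAffineMap.comp (T.bary s p)
  have hf : Set.EqOn (nodal hΩo hΩ u p).1 f (convexHull ℝ (s : Set (E d))) := fun y hy =>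
    nodal_eq_on_element hΩo hΩ hs u p hy
  rw [(hasFDerivAt_of_eqOn hf hx).fderiv]
  rfl

theorem vertexSq_eq {F : Type*} [Norm F] (c : ℝ) (g : E d → F) :
    ∑ s ∈ T.elems, ∑ p ∈ s, volume.real (cell s) * (c * ‖g p‖ ^ 2) = c * T.vertexSq g := by
  rw [vertexSq, Finset.mul_sum]
  refine Finset.sum_congr rfl fun s _ => ?_
  rw [Finset.mul_sum, Finset.mul_sum]
  exact Finset.sum_congr rfl fun p _ => by ring

theorem sum_l2_nodal_le (hΩo : IsOpen Ω) (hΩb : Bornology.IsBounded Ω)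
    (hΩ : interior (closure Ω) = Ω) (u : T.Vh m) :
    ∑ p : T.Vertex, l2 Ω (nodal hΩo hΩ u p).1 (nodal hΩo hΩ u p).1 ≤ T.vertexSq u.1 := by
  have hint := fun p => integrableOn_inner hΩo hΩb (nodal hΩo hΩ u p) (nodal hΩo hΩ u p)
  refine (sum_vertex_integral_le hΩ _ hint (fun s hs p hp x hx => ?_)
    (fun s p => volume.real (cell s) * (1 * ‖u.1 p‖ ^ 2)) fun s hs p hp => ?_).trans_eq ?_
  · rw [nodal_eq_on_element hΩo hΩ hs u p (cell_subset s hx), bary_of_notMem hp]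
    simp
  · refine setIntegral_cell_le ((hint p).mono_set (cell_subset_domain hΩ hs)) fun x hx => ?_
    have hx' := cell_subset s hx
    rw [nodal_eq_on_element hΩo hΩ hs u p hx', real_inner_self_eq_norm_sq, norm_smul, mul_pow,
      Real.norm_of_nonneg (bary_nonneg hs hx' p)]
    exact mul_le_mul_of_nonneg_right
      (pow_le_one₀ (bary_nonneg hs hx' p) (bary_le_one hs hx' p)) (sq_nonneg _)
  · rw [vertexSq_eq, one_mul]

/-- The inverse estimate: each of the `d` partial derivatives of a hat function is at most `1 / r`.
With `r = ρ h` this is the source of `h⁻²`. -/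
theorem sum_gradL2_nodal_le (hΩo : IsOpen Ω) (hΩb : Bornology.IsBounded Ω)
    (hΩ : interior (closure Ω) = Ω) {r : ℝ} (hr : 0 < r)
    (hball : ∀ s ∈ T.elements, ∃ c, Metric.closedBall c r ⊆ convexHull ℝ (s : Set (E d)))
    (u : T.Vh m) :
    ∑ p : T.Vertex, gradL2 Ω (nodal hΩo hΩ u p).1 (nodal hΩo hΩ u p).1
      ≤ d / r ^ 2 * T.vertexSq u.1 := by
  have hint := fun p => integrableOn_grad hΩo hΩb (nodal hΩo hΩ u p) (nodal hΩo hΩ u p)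
  refine (sum_vertex_integral_le hΩ _ hint (fun s hs p hp x hx => ?_)
    (fun s p => volume.real (cell s) * (d / r ^ 2 * ‖u.1 p‖ ^ 2)) fun s hs p hp => ?_).trans_eq ?_
  · simp [fderiv_nodal hΩo hΩ hs u p hx, bary_of_notMem hp]
  · refine setIntegral_cell_le ((hint p).mono_set (cell_subset_domain hΩ hs)) fun x hx => ?_
    obtain ⟨c, hc⟩ := hball s hs
    simp only [fderiv_nodal hΩo hΩ hs u p hx]
    have h : ∀ j : Fin d, inner ℝ ((T.bary s p).linear (EuclideanSpace.single j 1) • u.1 p)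
        ((T.bary s p).linear (EuclideanSpace.single j 1) • u.1 p)
        ≤ 1 / r ^ 2 * ‖u.1 p‖ ^ 2 := fun j => by
      have h1 := abs_linear_bary_le hs hr hc p (EuclideanSpace.single j 1)
      rw [PiLp.norm_single, norm_one] at h1
      rw [real_inner_self_eq_norm_sq, norm_smul, mul_pow, Real.norm_eq_abs]
      refine mul_le_mul_of_nonneg_right ?_ (sq_nonneg _)
      have h2 := pow_le_pow_left₀ (abs_nonneg _) h1 2
      rwa [div_pow, one_pow] at h2
    refine (Finset.sum_le_sum fun j _ => h j).trans_eq ?_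
    rw [Finset.sum_const, Finset.card_univ, Fintype.card_fin, nsmul_eq_mul]
    ring
  · rw [vertexSq_eq]

theorem sum_weight_nodal_le (hΩo : IsOpen Ω) (hΩb : Bornology.IsBounded Ω)
    (hΩ : interior (closure Ω) = Ω) {lam : E d → ℝ} (hlam : MemLp lam 2 (volume.restrict Ω))
    (hpos : ∀ᵐ x ∂(volume.restrict Ω), 0 ≤ lam x) {a : ℝ}
    (ha : ∀ s ∈ T.elements, ∫ x in cell s, lam x ≤ a * volume.real (cell s)) (u : T.Vh m) :
    ∑ p : T.Vertex, ∫ x in Ω, lam x * inner ℝ ((nodal hΩo hΩ u p).1 x) ((nodal hΩo hΩ u p).1 x)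
      ≤ a * T.vertexSq u.1 := by
  have hint := fun p =>
    integrableOn_weight_inner hΩo hΩb hlam (nodal hΩo hΩ u p) (nodal hΩo hΩ u p)
  refine (sum_vertex_integral_le hΩ _ hint (fun s hs p hp x hx => ?_)
    (fun s p => volume.real (cell s) * (a * ‖u.1 p‖ ^ 2)) fun s hs p hp => ?_).trans_eq ?_
  · rw [nodal_eq_on_element hΩo hΩ hs u p (cell_subset s hx), bary_of_notMem hp]
    simp
  · have hsub := cell_subset_domain hΩ hs
    have h1 : ∫ x in cell s, lam x * inner ℝ ((nodal hΩo hΩ u p).1 x) ((nodal hΩo hΩ u p).1 x)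
        ≤ ∫ x in cell s, lam x * ‖u.1 p‖ ^ 2 := by
      refine setIntegral_mono_ae_restrict ((hint p).mono_set hsub)
        (((integrableOn_weight hΩb hlam).mono_set hsub).mul_const _) ?_
      filter_upwards [ae_restrict_of_ae_restrict_of_subset hsub hpos,
        ae_restrict_mem (isOpen_cell s).measurableSet] with x hx hxs
      have hx' := cell_subset s hxs
      refine mul_le_mul_of_nonneg_left ?_ hx
      rw [nodal_eq_on_element hΩo hΩ hs u p hx', real_inner_self_eq_norm_sq, norm_smul, mul_pow,
        Real.norm_of_nonneg (bary_nonneg hs hx' p)]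
      exact mul_le_of_le_one_left (sq_nonneg _)
        (pow_le_one₀ (bary_nonneg hs hx' p) (bary_le_one hs hx' p))
    rw [integral_mul_const] at h1
    refine h1.trans ((mul_le_mul_of_nonneg_right (ha s hs) (sq_nonneg _)).trans_eq ?_)
    ring
  · rw [vertexSq_eq]

/-- Freezing `n` at the vertex separates the nodal value of `n · u`, which vanishes on the
approximate kernel, from an error governed by the oscillation `δ` of `n` on one element. -/
theorem sum_director_nodal_le (hΩo : IsOpen Ω) (hΩb : Bornology.IsBounded Ω)
    (hΩ : interior (closure Ω) = Ω) {n : E d → E m} (hn : T.IsP1 n) {δ : ℝ}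
    (hδ : ∀ s ∈ T.elements, ∀ x ∈ convexHull ℝ (s : Set (E d)),
      ∀ y ∈ convexHull ℝ (s : Set (E d)), ‖n x - n y‖ ≤ δ) (u : T.Vh m) :
    ∑ p : T.Vertex, ∫ x in Ω, inner ℝ (n x) ((nodal hΩo hΩ u p).1 x) *
        inner ℝ (n x) ((nodal hΩo hΩ u p).1 x)
      ≤ 2 * T.vertexSq (fun p => inner ℝ (n p) (u.1 p)) + 2 * δ ^ 2 * T.vertexSq u.1 := by
  have hint := fun p => integrableOn_director hΩo hΩb hn (nodal hΩo hΩ u p) (nodal hΩo hΩ u p)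
  refine (sum_vertex_integral_le hΩ _ hint (fun s hs p hp x hx => ?_)
    (fun s p => volume.real (cell s) * (2 * ‖inner ℝ (n p) (u.1 p)‖ ^ 2) +
      volume.real (cell s) * (2 * δ ^ 2 * ‖u.1 p‖ ^ 2)) fun s hs p hp => ?_).trans_eq ?_
  · rw [nodal_eq_on_element hΩo hΩ hs u p (cell_subset s hx), bary_of_notMem hp]
    simp
  · rw [← mul_add]
    refine setIntegral_cell_le ((hint p).mono_set (cell_subset_domain hΩ hs)) fun x hx => ?_
    have hx' := cell_subset s hx
    have hb0 := bary_nonneg hs hx' p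
    have hb1 : T.bary s p x ^ 2 ≤ 1 := pow_le_one₀ hb0 (bary_le_one hs hx' p)
    rw [nodal_eq_on_element hΩo hΩ hs u p hx', real_inner_smul_right, Real.norm_eq_abs, sq_abs]
    have h1 : inner ℝ (n x) (u.1 p) = inner ℝ (n p) (u.1 p) + inner ℝ (n x - n p) (u.1 p) := by
      rw [inner_sub_left]
      ring
    have h2 : inner ℝ (n x - n p) (u.1 p) ^ 2 ≤ δ ^ 2 * ‖u.1 p‖ ^ 2 := by
      rw [← mul_pow, ← sq_abs]
      refine pow_le_pow_left₀ (abs_nonneg _) ((abs_real_inner_le_norm _ _).trans ?_) 2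
      exact mul_le_mul_of_nonneg_right (hδ s hs x hx' p (subset_convexHull ℝ _ hp))
        (norm_nonneg _)
    have h3 : inner ℝ (n x) (u.1 p) ^ 2
        ≤ 2 * inner ℝ (n p) (u.1 p) ^ 2 + 2 * (δ ^ 2 * ‖u.1 p‖ ^ 2) := by
      rw [h1]
      linarith [sq_nonneg (inner ℝ (n p) (u.1 p) - inner ℝ (n x - n p) (u.1 p))]
    have h4 := mul_le_of_le_one_left (sq_nonneg (inner ℝ (n x) (u.1 p))) hb1
    calc T.bary s p x * inner ℝ (n x) (u.1 p) * (T.bary s p x * inner ℝ (n x) (u.1 p))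
        = T.bary s p x ^ 2 * inner ℝ (n x) (u.1 p) ^ 2 := by ring
      _ ≤ _ := by linarith
  · simp only [Finset.sum_add_distrib, vertexSq_eq]

/-- The nodal values of `n · u` are controlled by `n · u` in `L²`, up to a term that is small with
the oscillation of `n` on the elements. -/
theorem vertexSq_director_le (hΩo : IsOpen Ω) (hΩb : Bornology.IsBounded Ω)
    (hΩ : interior (closure Ω) = Ω) {n : E d → E m} (hn : T.IsP1 n) {δ : ℝ}
    (hδ : ∀ s ∈ T.elements, ∀ x ∈ convexHull ℝ (s : Set (E d)),
      ∀ y ∈ convexHull ℝ (s : Set (E d)), ‖n x - n y‖ ≤ δ) (u : T.Vh m) :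
    T.vertexSq (fun p => inner ℝ (n p) (u.1 p)) ≤ (d + 1) * 4 ^ (d + 1) *
      (2 * (∫ x in Ω, inner ℝ (n x) (u.1 x) * inner ℝ (n x) (u.1 x)) +
        2 * δ ^ 2 * T.vertexSq u.1) := by
  have hint := integrableOn_director hΩo hΩb hn u u
  rw [vertexSq, vertexSq, integral_eq_sum_cell T hΩ hint, Finset.mul_sum, Finset.mul_sum,
    ← Finset.sum_add_distrib, Finset.mul_sum]
  refine Finset.sum_le_sum fun s hs => ?_
  rw [mem_elems] at hs
  -- The affine interpolant of the nodal values of `n · u`. The function `n · u` itself is quadratic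
  -- on the element, so `mass_bound` applies only to `g`, which differs from it by an average of
  -- terms `(n(x) - n(p)) · u(p)`.
  let g : E d →ᵃ[ℝ] ℝ := ∑ p ∈ s, (inner ℝ (n p) (u.1 p) : ℝ) • T.bary s p
  have hg : ∀ x, g x = ∑ p ∈ s, T.bary s p x * inner ℝ (n p) (u.1 p) := fun x => by
    classical
    have h : ∀ t : Finset (E d), (∑ p ∈ t, (inner ℝ (n p) (u.1 p) : ℝ) • T.bary s p) x
        = ∑ p ∈ t, T.bary s p x * inner ℝ (n p) (u.1 p) := fun t => by
      induction t using Finset.induction_on with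
      | empty => rfl
      | insert p t hp ih =>
        rw [Finset.sum_insert hp, Finset.sum_insert hp, ← ih, AffineMap.coe_add, Pi.add_apply,
          AffineMap.coe_smul, Pi.smul_apply, smul_eq_mul, mul_comm]
    exact h s
  have hgp : ∀ p ∈ s, g p = inner ℝ (n p) (u.1 p) := fun p hp => by
    classical
    rw [hg, Finset.sum_eq_single p]
    · rw [bary_vertex hs p hp, if_pos rfl, one_mul]
    · intro q _ hq
      rw [bary_vertex hs q hp, if_neg hq, zero_mul]
    · exact fun h => absurd hp h
  have hmass := mass_bound hs g
  have hsum : ∑ p ∈ s, ‖inner ℝ (n p) (u.1 p)‖ ^ 2 = ∑ p ∈ s, ‖g p‖ ^ 2 :=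
    Finset.sum_congr rfl fun p hp => by rw [hgp p hp]
  rw [hsum]
  refine hmass.trans (mul_le_mul_of_nonneg_left ?_ (by positivity))
  have hint' := hint.mono_set (cell_subset_domain hΩ hs)
  have hconst : IntegrableOn (fun _ : E d => 2 * δ ^ 2 * ∑ p ∈ s, ‖u.1 p‖ ^ 2) (cell s) :=
    integrableOn_const (measure_cell_ne_top s)
  have hgc : Continuous g := g.continuous_of_finiteDimensional
  have hle : ∫ x in cell s, ‖g x‖ ^ 2 ≤ ∫ x in cell s,
      (2 * (inner ℝ (n x) (u.1 x) * inner ℝ (n x) (u.1 x)) +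
        2 * δ ^ 2 * ∑ p ∈ s, ‖u.1 p‖ ^ 2) := by
    refine setIntegral_mono_on (((hgc.norm.pow 2).continuousOn.integrableOn_compact
      (isCompact_element s)).mono_set (cell_subset s)) ((hint'.const_mul 2).add hconst)
      (isOpen_cell s).measurableSet fun x hx => ?_
    have hx' := cell_subset s hx
    have h1 : g x = inner ℝ (n x) (u.1 x)
        - ∑ p ∈ s, T.bary s p x * inner ℝ (n x - n p) (u.1 p) := by
      rw [hg, isP1_apply u.2.1 hs hx', inner_sum, ← Finset.sum_sub_distrib]
      refine Finset.sum_congr rfl fun p _ => ?_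
      rw [real_inner_smul_right, inner_sub_left]
      ring
    have h2 : (∑ p ∈ s, T.bary s p x * inner ℝ (n x - n p) (u.1 p)) ^ 2
        ≤ δ ^ 2 * ∑ p ∈ s, ‖u.1 p‖ ^ 2 := by
      have hj := sq_sum_bary_mul_le hs hx' (fun p => inner ℝ (n x - n p) (u.1 p))
      refine hj.trans ?_
      rw [Finset.mul_sum]
      refine Finset.sum_le_sum fun p hp => ?_
      rw [← mul_pow, ← sq_abs]
      refine pow_le_pow_left₀ (abs_nonneg _) ((abs_real_inner_le_norm _ _).trans ?_) 2
      exact mul_le_mul_of_nonneg_right (hδ s hs x hx' p (subset_convexHull ℝ _ hp))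
        (norm_nonneg _)
    rw [Real.norm_eq_abs, sq_abs, h1]
    linarith [sq_nonneg (inner ℝ (n x) (u.1 x)
      + ∑ p ∈ s, T.bary s p x * inner ℝ (n x - n p) (u.1 p))]
  refine hle.trans_eq ?_
  rw [integral_add (hint'.const_mul 2) hconst, integral_const_mul, setIntegral_const, smul_eq_mul]
  ring

/-! ### Quasi-uniform meshes -/

theorem QuasiUniform.norm_sub_le {ρ h : ℝ} (hT : T.QuasiUniform ρ h) (hs : s ∈ T.elements)
    {x y : E d} (hx : x ∈ convexHull ℝ (s : Set (E d))) (hy : y ∈ convexHull ℝ (s : Set (E d))) :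
    ‖x - y‖ ≤ h := by
  rw [← dist_eq_norm]
  exact (Metric.dist_le_diam_of_mem (isCompact_element s).isBounded hx hy).trans (hT.2 s hs).1

/-- The ball of radius `ρ h` in an element lies in the ball of radius `R`. Thus `h ≤ R / ρ`, so
constants and lower powers of `h⁻¹` can be bounded by multiples of `h⁻²`. -/
theorem QuasiUniform.mul_le (hd : 0 < d) (hΩne : Ω.Nonempty) {R : ℝ} (hR : ∀ x ∈ Ω, ‖x‖ ≤ R)
    {ρ h : ℝ} (hρ : 0 < ρ) (hT : T.QuasiUniform ρ h) : ρ * h ≤ R := by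
  have hR' : closure Ω ⊆ Metric.closedBall 0 R :=
    closure_minimal (fun x hx => mem_closedBall_zero_iff.2 (hR x hx)) Metric.isClosed_closedBall
  obtain ⟨x, hx⟩ := hΩne
  obtain ⟨s, hs, -⟩ := exists_mem_element (T := T) (subset_closure hx)
  obtain ⟨c, hc⟩ := (hT.2 s hs).2
  have hr : 0 < ρ * h := mul_pos hρ hT.1
  have hsub := (hc.trans (convexHull_subset_closure hs)).trans hR'
  let e : E d := EuclideanSpace.single ⟨0, hd⟩ (ρ * h)
  have he : ‖e‖ = ρ * h := by
    simp only [e, PiLp.norm_single]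
    exact Real.norm_of_nonneg hr.le
  have h1 : ‖c + e‖ ≤ R := mem_closedBall_zero_iff.1 (hsub (by simp [he]))
  have h2 : ‖c - e‖ ≤ R := mem_closedBall_zero_iff.1 (hsub (by simp [he]))
  have h3 := _root_.norm_sub_le (c + e) (c - e)
  have h4 : (c + e) - (c - e) = (2 : ℝ) • e := by module
  rw [h4, norm_smul, he, Real.norm_ofNat] at h3
  linarith

theorem le_measure_cell {c : E d} {r : ℝ} (hr : 0 < r)
    (hc : Metric.closedBall c r ⊆ convexHull ℝ (s : Set (E d))) :
    volume.real (Metric.ball (0 : E d) 1) * r ^ d ≤ volume.real (cell s) := by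
  have hsub : Metric.ball c r ⊆ cell s :=
    interior_maximal (Metric.ball_subset_closedBall.trans hc) Metric.isOpen_ball
  have h : volume.real (Metric.ball c r) = volume.real (Metric.ball (0 : E d) 1) * r ^ d := by
    rw [measureReal_def, Measure.addHaar_ball_of_pos _ _ hr, ENNReal.toReal_mul,
      ENNReal.toReal_ofReal (by positivity), finrank_euclideanSpace_fin, mul_comm]
    rfl
  rw [← h]
  exact measureReal_mono hsub (measure_cell_ne_top s)

/-- In dimension at most four, the elements of a quasi-uniform mesh have volume at least a multiple
of `h ^ 4`. -/
theorem QuasiUniform.le_measure_cell_of_le (hd : d ≤ 4) {ρ h H : ℝ} (hρ : 0 < ρ) (hH : 0 < H)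
    (hhH : h ≤ H) (hT : T.QuasiUniform ρ h) (hs : s ∈ T.elements) :
    volume.real (Metric.ball (0 : E d) 1) * ρ ^ d / H ^ (4 - d) * h ^ 4
      ≤ volume.real (cell s) := by
  obtain ⟨c, hc⟩ := (hT.2 s hs).2
  have hh := hT.1
  refine le_trans ?_ (le_measure_cell (mul_pos hρ hh) hc)
  have h4 : h ^ 4 ≤ h ^ d * H ^ (4 - d) := by
    calc h ^ 4 = h ^ d * h ^ (4 - d) := by rw [← pow_add, Nat.add_sub_cancel' hd]
      _ ≤ h ^ d * H ^ (4 - d) := by gcongr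
  rw [div_mul_eq_mul_div, div_le_iff₀ (by positivity), mul_pow]
  calc volume.real (Metric.ball (0 : E d) 1) * ρ ^ d * h ^ 4
      ≤ volume.real (Metric.ball (0 : E d) 1) * ρ ^ d * (h ^ d * H ^ (4 - d)) := by gcongr
    _ = _ := by ring

theorem QuasiUniform.integral_weight_le (hd : d ≤ 4) (hΩ : interior (closure Ω) = Ω)
    {ρ h H : ℝ} (hρ : 0 < ρ) (hH : 0 < H) (hhH : h ≤ H) (hT : T.QuasiUniform ρ h)
    (hs : s ∈ T.elements) {lam : E d → ℝ} (hlam : MemLp lam 2 (volume.restrict Ω))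
    (hpos : ∀ᵐ x ∂(volume.restrict Ω), 0 ≤ lam x) {Λ : ℝ}
    (hΛ : eLpNorm lam 2 (volume.restrict Ω) ≤ ENNReal.ofReal Λ) :
    ∫ x in cell s, lam x
      ≤ |Λ| / √(volume.real (Metric.ball (0 : E d) 1) * ρ ^ d / H ^ (4 - d)) / h ^ 2
        * volume.real (cell s) := by
  set c := volume.real (Metric.ball (0 : E d) 1) * ρ ^ d / H ^ (4 - d)
  set v := volume.real (cell s)
  have hh := hT.1
  have hball : 0 < volume.real (Metric.ball (0 : E d) 1) :=
    ENNReal.toReal_pos (Metric.measure_ball_pos volume _ one_pos).ne' measure_ball_lt_top.ne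
  have hc0 : 0 < c := by positivity
  have hv : c * h ^ 4 ≤ v := hT.le_measure_cell_of_le hd hρ hH hhH hs
  -- The volume bound `c * h ^ 4 ≤ v` is what turns the `√v` of Hölder's inequality into at most `v
  -- / (√c * h ^ 2)`.
  have hsq : √c * h ^ 2 ≤ √v := by
    refine Real.le_sqrt_of_sq_le ?_
    rw [mul_pow, Real.sq_sqrt hc0.le]
    refine le_trans (le_of_eq ?_) hv
    ring
  have hv0 : 0 ≤ v := measureReal_nonneg
  refine (integral_cell_weight_le hΩ hs hlam hpos hΛ).trans ?_
  rw [div_div, div_mul_eq_mul_div, le_div_iff₀ (by positivity), mul_assoc]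
  refine mul_le_mul_of_nonneg_left ?_ (abs_nonneg _)
  calc √v * (√c * h ^ 2) ≤ √v * √v := mul_le_mul_of_nonneg_left hsq (Real.sqrt_nonneg _)
    _ = v := Real.mul_self_sqrt hv0

/-! ### Coercivity -/

theorem gradL2_self_nonneg (Ω : Set (E d)) (u : E d → E m) : 0 ≤ gradL2 Ω u u :=
  integral_nonneg fun _ => Finset.sum_nonneg fun _ _ => real_inner_self_nonneg

theorem l2_self_nonneg (Ω : Set (E d)) (u : E d → E m) : 0 ≤ l2 Ω u u :=
  integral_nonneg fun _ => real_inner_self_nonneg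

theorem director_self_nonneg (Ω : Set (E d)) (n u : E d → E m) :
    0 ≤ ∫ x in Ω, inner ℝ (n x) (u x) * inner ℝ (n x) (u x) :=
  integral_nonneg fun _ => mul_self_nonneg _

theorem weight_self_nonneg {lam : E d → ℝ} (hpos : ∀ᵐ x ∂(volume.restrict Ω), 0 ≤ lam x)
    (u : E d → E m) : 0 ≤ ∫ x in Ω, lam x * inner ℝ (u x) (u x) := by
  refine integral_nonneg_of_ae ?_
  filter_upwards [hpos] with x hx using mul_nonneg hx real_inner_self_nonneg

theorem eq_zero_of_l2_nonpos (hΩo : IsOpen Ω) (hΩb : Bornology.IsBounded Ω)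
    (hΩ : interior (closure Ω) = Ω) {u : T.Vh m} (hu : l2 Ω u.1 u.1 ≤ 0) : u = 0 := by
  have hnn : ∀ s ∈ T.elems, 0 ≤ volume.real (cell s) * ∑ p ∈ s, ‖u.1 p‖ ^ 2 := fun s _ =>
    mul_nonneg measureReal_nonneg (Finset.sum_nonneg fun _ _ => sq_nonneg _)
  have h0 : T.vertexSq u.1 = 0 := by
    refine le_antisymm ((vertexSq_le hΩo hΩb hΩ u).trans ?_) (vertexSq_nonneg _)
    exact mul_nonpos_of_nonneg_of_nonpos (by positivity) hu
  rw [vertexSq, Finset.sum_eq_zero_iff_of_nonneg hnn] at h0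
  apply Subtype.ext
  funext x
  by_cases hx : x ∈ closure Ω
  · obtain ⟨s, hs, hxs⟩ := exists_mem_element (T := T) hx
    have hv : volume.real (cell s) ≠ 0 :=
      (ENNReal.toReal_pos (measure_cell_pos hs).ne' (measure_cell_ne_top s)).ne'
    have h1 := (mul_eq_zero.1 (h0 s (mem_elems.2 hs))).resolve_left hv
    rw [Finset.sum_eq_zero_iff_of_nonneg fun _ _ => sq_nonneg _] at h1
    rw [isP1_apply u.2.1 hs hxs]
    refine Finset.sum_eq_zero fun p hp => ?_
    have h2 : u.1 p = 0 := norm_eq_zero.1 (pow_eq_zero_iff two_ne_zero |>.1 (h1 p hp))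
    rw [h2, smul_zero]
  · exact u.2.2 x fun h => hx (subset_closure h)

/-! ### The nodal splitting -/

/-- Nonnegativity of `N` bounds the set of values below, as a real `sInf` requires before one member
can bound it from above. -/
theorem splitInf_le_nodal (hΩo : IsOpen Ω) (hΩ : interior (closure Ω) = Ω)
    {V : T.Vertex → Submodule ℝ (T.Vh m)} (hV : ∀ u, ∀ p : T.Vertex, nodal hΩo hΩ u p ∈ V p)
    {N : T.Vh m → ℝ} (hN : ∀ w, 0 ≤ N w) (u : T.Vh m) :
    splitInf V N u ≤ ∑ p : T.Vertex, N (nodal hΩo hΩ u p) := by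
  refine csInf_le ⟨0, ?_⟩ ⟨fun p => nodal hΩo hΩ u p, hV u, sum_nodal hΩo hΩ u, rfl⟩
  rintro _ ⟨w, -, -, rfl⟩
  exact Finset.sum_nonneg fun p _ => hN _

theorem iSup_eq_top_of_nodal_mem (hΩo : IsOpen Ω) (hΩ : interior (closure Ω) = Ω)
    {V : T.Vertex → Submodule ℝ (T.Vh m)} (hV : ∀ u, ∀ p : T.Vertex, nodal hΩo hΩ u p ∈ V p) :
    ⨆ p, V p = ⊤ := by
  rw [eq_top_iff]
  intro u _
  rw [← sum_nodal hΩo hΩ u]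
  exact Submodule.sum_mem _ fun p _ => Submodule.mem_iSup_of_mem p (hV u p)

theorem sum_h1Sq_nodal_le (hΩo : IsOpen Ω) (hΩb : Bornology.IsBounded Ω)
    (hΩ : interior (closure Ω) = Ω) {r : ℝ} (hr : 0 < r)
    (hball : ∀ s ∈ T.elements, ∃ c, Metric.closedBall c r ⊆ convexHull ℝ (s : Set (E d)))
    (u : T.Vh m) :
    ∑ p : T.Vertex, h1Sq Ω (nodal hΩo hΩ u p).1 ≤ (1 + d / r ^ 2) * T.vertexSq u.1 := by
  simp only [h1Sq, Finset.sum_add_distrib]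
  have h1 := sum_l2_nodal_le hΩo hΩb hΩ u
  have h2 := sum_gradL2_nodal_le hΩo hΩb hΩ hr hball u
  linarith

theorem sum_aForm_nodal_le (hΩo : IsOpen Ω) (hΩb : Bornology.IsBounded Ω)
    (hΩ : interior (closure Ω) = Ω) {r : ℝ} (hr : 0 < r)
    (hball : ∀ s ∈ T.elements, ∃ c, Metric.closedBall c r ⊆ convexHull ℝ (s : Set (E d)))
    {lam : E d → ℝ} (hlam : MemLp lam 2 (volume.restrict Ω))
    (hpos : ∀ᵐ x ∂(volume.restrict Ω), 0 ≤ lam x) {a : ℝ}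
    (ha : ∀ s ∈ T.elements, ∫ x in cell s, lam x ≤ a * volume.real (cell s))
    {n : E d → E m} (hn : T.IsP1 n) {δ : ℝ}
    (hδ : ∀ s ∈ T.elements, ∀ x ∈ convexHull ℝ (s : Set (E d)),
      ∀ y ∈ convexHull ℝ (s : Set (E d)), ‖n x - n y‖ ≤ δ) {K γ : ℝ} (hK : 0 ≤ K) (hγ : 0 ≤ γ)
    (u : T.Vh m) :
    ∑ p : T.Vertex, aForm Ω K γ lam n (nodal hΩo hΩ u p).1 (nodal hΩo hΩ u p).1
      ≤ (K * (d / r ^ 2) + 2 * a) * T.vertexSq u.1 + 4 * γ *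
        (2 * T.vertexSq (fun p => inner ℝ (n p) (u.1 p)) + 2 * δ ^ 2 * T.vertexSq u.1) := by
  simp only [aForm, Finset.sum_add_distrib, ← Finset.mul_sum]
  have h1 := mul_le_mul_of_nonneg_left (sum_gradL2_nodal_le hΩo hΩb hΩ hr hball u) hK
  have h2 := sum_weight_nodal_le hΩo hΩb hΩ hlam hpos ha u
  have h3 := mul_le_mul_of_nonneg_left (sum_director_nodal_le hΩo hΩb hΩ hn hδ u)
    (by positivity : 0 ≤ 4 * γ)
  linarith

end Triangulation

theorem ncard_le_overlap {d m : ℕ} {ι : Type*} [Finite ι] {W : Submodule ℝ (E d → E m)}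
    (V : ι → Submodule ℝ W) (i : ι) :
    {j | ∃ v ∈ V i, ∃ v' ∈ V j,
      0 < volume (tsupport (v : E d → E m) ∩ tsupport (v' : E d → E m))}.ncard ≤ overlap V :=
  le_ciSup (f := fun i => {j | ∃ v ∈ V i, ∃ v' ∈ V j,
    0 < volume (tsupport (v : E d → E m) ∩ tsupport (v' : E d → E m))}.ncard)
    (Set.finite_range _).bddAbove i

end LiquidCrystal
end

/-! ### The main theorem: choice of constants and assembly -/

open LiquidCrystal in
theorem corollary5p3 (d m : ℕ) (hd : d = 2 ∨ d = 3) (Ω : Set (E d)) (hΩo : IsOpen Ω)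
    (hΩb : Bornology.IsBounded Ω) (hΩne : Ω.Nonempty) (hΩreg : interior (closure Ω) = Ω)
    (K ρ Λ : ℝ) (hK : 0 < K) (hρ : 0 < ρ) :
    ∃ (C : ℝ) (c₁ c₂ : ℝ → ℝ), 0 < C ∧
      (∀ h, 0 < h → 0 < c₁ h ∧ c₁ h ≤ C / h ^ 2 ∧ 0 < c₂ h ∧ c₂ h ≤ C / h ^ 2) ∧
      ∀ (T : Triangulation d Ω) (h : ℝ), T.QuasiUniform ρ h →
      ∀ (γ : ℝ), 0 ≤ γ →
      ∀ (n : E d → E m), T.IsP1 n →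
      ∀ (lam : E d → ℝ), MemLp lam 2 (volume.restrict Ω) →
        (∀ᵐ x ∂(volume.restrict Ω), 0 ≤ lam x) →
        eLpNorm lam 2 (volume.restrict Ω) ≤ ENNReal.ofReal Λ →
      ∀ (V : T.Vertex → Submodule ℝ (T.Vh m)),
        (V = T.starSpace m ∨ V = T.pointBlockSpace m) →
        (⨆ p, V p) = ⊤ ∧
        (∀ u : T.Vh m, splitInf V (fun w => h1Sq Ω (w : E d → E m)) u ≤ c₁ h * l2 Ω u.1 u.1) ∧
        (∀ u ∈ T.approxKernel n,
          splitInf V (fun w => aForm Ω K γ lam n (w : E d → E m) (w : E d → E m)) u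
            ≤ (c₂ h + C * γ * h ^ 2 * jacobianSup Ω n ^ 2) * l2 Ω u.1 u.1) ∧
        ∃ D : T.Vh m ≃ₗ[ℝ] Module.Dual ℝ (T.Vh m),
          IsAdditiveSchwarz V (fun u v => aForm Ω K γ lam n (u : E d → E m) (v : E d → E m)) D ∧
          ∀ u : T.Vh m,
            (c₁ h + c₂ h + C * γ * h ^ 2 * jacobianSup Ω n ^ 2)⁻¹ * D u u
              ≤ aForm Ω K γ lam n u.1 u.1 ∧
            aForm Ω K γ lam n u.1 u.1 ≤ (overlap V : ℝ) * D u u := by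
  have hd0 : 0 < d := by omega
  have hd4 : d ≤ 4 := by omega
  obtain ⟨R, hR0, hR⟩ : ∃ R : ℝ, 0 < R ∧ ∀ x ∈ Ω, ‖x‖ ≤ R := by
    obtain ⟨R, hR0, hR⟩ := hΩb.exists_pos_norm_le
    exact ⟨R, hR0, hR⟩
  let H : ℝ := R / ρ
  have hH : 0 < H := div_pos hR0 hρ
  let M : ℝ := (d + 1) * 4 ^ (d + 1)
  have hM : 0 < M := by positivity
  let b : ℝ := |Λ| / √(volume.real (Metric.ball (0 : E d) 1) * ρ ^ d / H ^ (4 - d))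
  have hb : 0 ≤ b := by positivity
  let A : ℝ := K * (d / ρ ^ 2) + 2 * b
  have hA : 0 ≤ A := by positivity
  let P : ℝ := 4 * R ^ 2 / K
  have hP : 0 < P := by positivity
  -- The sum of the constants of all estimates below, so that each is at most `C`: the `H¹`
  -- splitting, then the two coefficients on the approximate kernel, then the two coefficients in
  -- the bound for `D`.
  let C : ℝ := M * (H ^ 2 + d / ρ ^ 2) + A * M + 8 * M + (A * M * P + 4 * M * H ^ 2) +
    (16 * M + 8) * M * P
  have t1 : 0 ≤ M * (H ^ 2 + d / ρ ^ 2) := by positivity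
  have t2 : 0 ≤ A * M := by positivity
  have t4 : 0 ≤ A * M * P + 4 * M * H ^ 2 := by positivity
  have t5 : 0 ≤ (16 * M + 8) * M * P := by positivity
  have hC : 0 < C := by
    simp only [C]
    linarith
  refine ⟨C, fun h => C / h ^ 2, fun h => C / h ^ 2, hC, fun h hh => ?_, ?_⟩
  · have h1 : 0 < C / h ^ 2 := by positivity
    exact ⟨h1, le_rfl, h1, le_rfl⟩
  intro T h hT γ hγ n hn lam hlam hpos hΛ V hV
  have hh := hT.1
  have hhH : h ≤ H := by
    rw [le_div_iff₀ hρ, mul_comm]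
    exact hT.mul_le hd0 hΩne hR hρ
  -- Used to rewrite terms independent of `h` as multiples of `h⁻²`.
  have hq : 1 ≤ H ^ 2 / h ^ 2 := by
    rw [one_le_div (by positivity)]
    gcongr
  have hVn : ∀ u, ∀ p : T.Vertex, Triangulation.nodal hΩo hΩreg u p ∈ V p := by
    rcases hV with rfl | rfl
    · exact Triangulation.nodal_mem_starSpace hΩo hΩreg
    · exact Triangulation.nodal_mem_pointBlockSpace hΩo hΩreg
  have hball : ∀ s ∈ T.elements, ∃ c,
      Metric.closedBall c (ρ * h) ⊆ convexHull ℝ (s : Set (E d)) := fun s hs => (hT.2 s hs).2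
  have hr : 0 < ρ * h := mul_pos hρ hh
  set J := jacobianSup Ω n
  have hJ0 : 0 ≤ J := ENNReal.toReal_nonneg
  have hδ : ∀ s ∈ T.elements, ∀ x ∈ convexHull ℝ (s : Set (E d)),
      ∀ y ∈ convexHull ℝ (s : Set (E d)), ‖n x - n y‖ ≤ J * h := fun s hs x hx y hy =>
    (Triangulation.norm_sub_le_jacobianSup hΩreg hn hs hx hy).trans
      (mul_le_mul_of_nonneg_left (hT.norm_sub_le hs hx hy) hJ0)
  have hw : ∀ s ∈ T.elements, ∫ x in Triangulation.cell s, lam x ≤ b / h ^ 2 * volume.real (Triangulation.cell s) :=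
    fun s hs => hT.integral_weight_le hd4 hΩreg hρ hH hhH hs hlam hpos hΛ
  have hQ := fun u : T.Vh m => Triangulation.vertexSq_le hΩo hΩb hΩreg u
  have hQ0 := fun u : T.Vh m => T.vertexSq_nonneg u.1
  have hnn : ∀ u : T.Vh m, 0 ≤ aForm Ω K γ lam n u.1 u.1 := fun u => by
    have h1 := mul_nonneg hK.le (Triangulation.gradL2_self_nonneg Ω u.1)
    have h2 := Triangulation.weight_self_nonneg hpos u.1
    have h3 := mul_nonneg (by positivity : 0 ≤ 4 * γ) (Triangulation.director_self_nonneg Ω n u.1)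
    rw [aForm]
    linarith
  have hl2 : ∀ u : T.Vh m, l2 Ω u.1 u.1 ≤ P * aForm Ω K γ lam n u.1 u.1 := fun u => by
    have h0 := Triangulation.poincare hd0 hΩo hΩb hΩreg hR u
    have h2 := Triangulation.weight_self_nonneg hpos u.1
    have h3 := mul_nonneg (by positivity : 0 ≤ 4 * γ) (Triangulation.director_self_nonneg Ω n u.1)
    have h4 : K * gradL2 Ω u.1 u.1 ≤ aForm Ω K γ lam n u.1 u.1 := by
      rw [aForm]
      linarith
    refine h0.trans ?_
    calc 4 * R ^ 2 * gradL2 Ω u.1 u.1 = P * (K * gradL2 Ω u.1 u.1) := by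
          simp only [P]
          field_simp
      _ ≤ _ := mul_le_mul_of_nonneg_left h4 hP.le
  have hdir : ∀ u : T.Vh m, 4 * γ * (∫ x in Ω, inner ℝ (n x) (u.1 x) * inner ℝ (n x) (u.1 x))
      ≤ aForm Ω K γ lam n u.1 u.1 := fun u => by
    have h1 := mul_nonneg hK.le (Triangulation.gradL2_self_nonneg Ω u.1)
    have h2 := Triangulation.weight_self_nonneg hpos u.1
    rw [aForm]
    linarith
  have hsum : ∀ u : T.Vh m,
      ∑ p : T.Vertex, aForm Ω K γ lam n (Triangulation.nodal hΩo hΩreg u p).1 (Triangulation.nodal hΩo hΩreg u p).1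
        ≤ A / h ^ 2 * T.vertexSq u.1 + 4 * γ *
          (2 * T.vertexSq (fun p => inner ℝ (n p) (u.1 p)) +
            2 * (J * h) ^ 2 * T.vertexSq u.1) := fun u => by
    refine (Triangulation.sum_aForm_nodal_le hΩo hΩb hΩreg hr hball hlam hpos hw hn hδ hK.le hγ u).trans_eq ?_
    congr 2
    simp only [A]
    field_simp
  have htop := Triangulation.iSup_eq_top_of_nodal_mem hΩo hΩreg hVn
  refine ⟨htop, fun u => ?_, fun u hu => ?_, ?_⟩
  · refine (Triangulation.splitInf_le_nodal hΩo hΩreg hVn (fun w =>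
      add_nonneg (Triangulation.l2_self_nonneg Ω w.1) (Triangulation.gradL2_self_nonneg Ω w.1)) u).trans ?_
    refine (Triangulation.sum_h1Sq_nodal_le hΩo hΩb hΩreg hr hball u).trans ?_
    have hl := Triangulation.l2_self_nonneg Ω u.1
    calc (1 + d / (ρ * h) ^ 2) * T.vertexSq u.1
        ≤ (H ^ 2 / h ^ 2 + d / (ρ * h) ^ 2) * (M * l2 Ω u.1 u.1) := by
          have := hQ0 u
          gcongr
          exact hQ u
      _ = M * (H ^ 2 + d / ρ ^ 2) / h ^ 2 * l2 Ω u.1 u.1 := by field_simp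
      _ ≤ C / h ^ 2 * l2 Ω u.1 u.1 := by
          gcongr
          simp only [C]
          linarith
  · refine (Triangulation.splitInf_le_nodal hΩo hΩreg hVn hnn u).trans ((hsum u).trans ?_)
    have hzero : T.vertexSq (fun p => inner ℝ (n p) (u.1 p)) = 0 := by
      refine Finset.sum_eq_zero fun s hs => mul_eq_zero_of_right _ ?_
      refine Finset.sum_eq_zero fun p hp => ?_
      have h0 : inner ℝ (n p) (u.1 p) = 0 := hu ⟨p, Triangulation.mem_vertices_of_mem_element (Triangulation.mem_elems.1 hs) hp⟩
      simp [h0]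
    rw [hzero]
    have hl := Triangulation.l2_self_nonneg Ω u.1
    calc A / h ^ 2 * T.vertexSq u.1 + 4 * γ * (2 * 0 + 2 * (J * h) ^ 2 * T.vertexSq u.1)
        = (A / h ^ 2 + 8 * γ * h ^ 2 * J ^ 2) * T.vertexSq u.1 := by ring
      _ ≤ (A / h ^ 2 + 8 * γ * h ^ 2 * J ^ 2) * (M * l2 Ω u.1 u.1) := by
          gcongr
          exact hQ u
      _ = (A * M / h ^ 2 + 8 * M * γ * h ^ 2 * J ^ 2) * l2 Ω u.1 u.1 := by ring
      _ ≤ (C / h ^ 2 + C * γ * h ^ 2 * J ^ 2) * l2 Ω u.1 u.1 := by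
          gcongr <;> simp only [C] <;> linarith
  · obtain ⟨B, hB⟩ := Triangulation.exists_bilinear_aForm (T := T) (m := m) hΩo hΩb hΩreg K γ hlam hn
    have hBs : ∀ u v, B u v = B v u := fun u v => by rw [hB, hB, Triangulation.aForm_comm]
    have hBn : ∀ u, 0 ≤ B u u := fun u => by
      rw [hB]
      exact hnn u
    -- Definiteness comes from the gradient term through the Poincaré inequality, as the weight and
    -- `γ` may vanish.
    have hBp : ∀ u, u ≠ 0 → 0 < B u u := fun u hu => by
      refine lt_of_le_of_ne (hBn u) fun h0 => hu (Triangulation.eq_zero_of_l2_nonpos hΩo hΩb hΩreg ?_)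
      have h1 := hl2 u
      rwa [← hB, ← h0, mul_zero] at h1
    obtain ⟨D, hD, hDw, hDmin⟩ := exists_additiveSchwarz B hBs hBp V htop
    have hBa : (fun u v : T.Vh m => B u v) =
        fun u v : T.Vh m => aForm Ω K γ lam n (u : E d → E m) (v : E d → E m) :=
      funext fun u => funext fun v => hB u v
    refine ⟨D, hBa ▸ hD, fun u => ⟨?_, ?_⟩⟩
    · have hc : 0 < C / h ^ 2 + C / h ^ 2 + C * γ * h ^ 2 * J ^ 2 := by positivity
      rw [inv_mul_le_iff₀ hc]
      refine (hDmin u _ (hVn u) (Triangulation.sum_nodal hΩo hΩreg u)).trans ?_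
      simp only [hB]
      refine (hsum u).trans ?_
      have hG := Triangulation.vertexSq_director_le hΩo hΩb hΩreg hn hδ u
      have hl := Triangulation.l2_self_nonneg Ω u.1
      have ha := hnn u
      have hQa : T.vertexSq u.1 ≤ M * (P * aForm Ω K γ lam n u.1 u.1) :=
        (hQ u).trans (mul_le_mul_of_nonneg_left (hl2 u) hM.le)
      set G := ∫ x in Ω, inner ℝ (n x) (u.1 x) * inner ℝ (n x) (u.1 x)
      set a := aForm Ω K γ lam n u.1 u.1
      calc A / h ^ 2 * T.vertexSq u.1 + 4 * γ *
            (2 * T.vertexSq (fun p => inner ℝ (n p) (u.1 p)) +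
              2 * (J * h) ^ 2 * T.vertexSq u.1)
          ≤ A / h ^ 2 * T.vertexSq u.1 + 4 * γ *
            (2 * (M * (2 * G + 2 * (J * h) ^ 2 * T.vertexSq u.1)) +
              2 * (J * h) ^ 2 * T.vertexSq u.1) := by
            gcongr
        _ = (A / h ^ 2 + (16 * M + 8) * γ * h ^ 2 * J ^ 2) * T.vertexSq u.1 +
              4 * M * (4 * γ * G) * 1 := by ring
        -- The director term `4 * γ * G` is already part of the energy `a`, so its factor does not
        -- depend on `γ`; the discrete norm is bounded by the energy through `hQa`.
        _ ≤ (A / h ^ 2 + (16 * M + 8) * γ * h ^ 2 * J ^ 2) * (M * (P * a)) +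
              4 * M * a * (H ^ 2 / h ^ 2) := by
            gcongr
            exact hdir u
        _ = ((A * M * P + 4 * M * H ^ 2) / h ^ 2 +
              (16 * M + 8) * M * P * γ * h ^ 2 * J ^ 2) * a := by ring
        _ ≤ (C / h ^ 2 + C * γ * h ^ 2 * J ^ 2) * a := by
            gcongr <;> simp only [C] <;> linarith
        _ ≤ (C / h ^ 2 + C / h ^ 2 + C * γ * h ^ 2 * J ^ 2) * a := by
            refine mul_le_mul_of_nonneg_right ?_ ha
            have h1 : 0 < C / h ^ 2 := by positivity
            linarith
    · obtain ⟨w, hwV, hwu, hwD⟩ := hDw u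
      rw [← hB, hwD, ← hwu]
      refine energy_sum_le B hBs hBn w (fun i => {j | ∃ v ∈ V i, ∃ v' ∈ V j,
        0 < volume (tsupport (v : E d → E m) ∩ tsupport (v' : E d → E m))}) (fun i j => ?_)
        (fun i j hij => ?_) _ (ncard_le_overlap V)
      · constructor <;> rintro ⟨v, hv, v', hv', h0⟩ <;>
          exact ⟨v', hv', v, hv, by rwa [Set.inter_comm]⟩
      · rw [hB]
        refine Triangulation.aForm_eq_zero_of_measure_inter _ _ _ _ _ _ _ ?_
        by_contra h0
        exact hij ⟨w i, hwV i, w j, hwV j, pos_iff_ne_zero.2 h0⟩
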